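/- Let $P_0(D)=\sum_{|\alpha|\le m}a_\alpha D^\alpha$, $a_\alpha\in\mathbb{R}$, $D_j=-i\,\partial/\partial x_j$, be a constant coefficient differential operator of order $m\ge 2$ on $\mathbb{R}^n$ with $\widetilde P_0(\xi)=\big(\sum_{\alpha}|\partial^\alpha P_0(\xi)|^2\big)^{1/2}\to\infty$ as $|\xi|\to\infty$. Let $\Omega\subset\mathbb{R}^n$ be a bounded domain and let $V\in L^\infty(\mathbb{R}^n)$ be real-valued with $\operatorname{supp}V=\overline\Omega$ and $V\ge\delta>0$ a.e. in $\overline\Omega$. Let $H_0^{P_0}(\Omega)\subset L^2(\Omega)$ be the completion of $C_0^\infty(\Omega)$ in the norm $\|\varphi\|_{P_0}=\|P_0(D)\varphi\|_{L^2(\Omega)}$, and for $\lambda\in\mathbb{R}$ put $$B_\lambda(u,v)=\Big\langle \tfrac1V(P_0-\lambda)u,\,(P_0+V-\lambda)v\Big\rangle_{L^2(\Omega)},\qquad u,v\in H_0^{P_0}(\Omega).$$ A number $\lambda\in\mathbb{C}$ is a transmission eigenvalue if there are $0\ne v\in L^2_{\rm loc}(\Omega)$ and $0\neq w\in L^2_{\rm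 loc}(\Omega)$ with $(P_0-\lambda)v=0$ and $(P_0+V-\lambda)w=0$ in $\mathcal{D}'(\Omega)$ and $v-w\in H_0^{P_0}(\Omega)$. Call $\lambda_0\in\mathbb{R}$ a coercivity point if there is $c>0$ with $B_{\lambda_0}(u,u)\ge c\|u\|_{P_0}^2$ for all $u\in H_0^{P_0}(\Omega)$. (i) If $P_0(\xi)$ or $-P_0(\xi)$ is bounded from below on $\mathbb{R}^n$, then a coercivity point exists. (ii) Let $\lambda_0$ be any coercivity point. If for some $\lambda\in\mathbb{R}$ there is $0\ne u\in H_0^{P_0}(\Omega)$ with $B_\lambda(u,u)\le 0$, then there is a transmission eigenvalue $\lambda^*\in(\lambda_0,\lambda]$ if $\lambda_0<\lambda$, and a transmission eigenvalue $\lambda^*\in[\lambda,\lambda_0)$ if $\lambda_0>\lambda$. -/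

import Mathlib

open MeasureTheory Filter Topology
open scoped ENNReal Distributions

noncomputable section

namespace ITP

/-- `ℝⁿ` with its Euclidean norm and Lebesgue measure. -/
abbrev E (n : ℕ) : Type := EuclideanSpace ℝ (Fin n)

/-- `D_j = -i ∂/∂x_j`. -/
def D {n : ℕ} (j : Fin n) (φ : E n → ℂ) : E n → ℂ :=
  fun x => -Complex.I * fderiv ℝ φ x (EuclideanSpace.single j 1)

/-- `D^α = D_1^{α_1} ⋯ D_n^{α_n}`, for a multi-index `α`. -/
def DPow {n : ℕ} (α : Fin n →₀ ℕ) (φ : E n → ℂ) : E n → ℂ :=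
  (List.finRange n).foldr (fun j g => (D j)^[α j] g) φ

/-- The constant coefficient operator `P(D) = ∑ a_α D^α` with real symbol `P(ξ) = ∑ a_α ξ^α`. -/
def opD {n : ℕ} (P : MvPolynomial (Fin n) ℝ) (φ : E n → ℂ) : E n → ℂ :=
  fun x => ∑ α ∈ P.support, ((P.coeff α : ℝ) : ℂ) * DPow α φ x

/-- The transpose `P(-D) = ∑ (-1)^{|α|} a_α D^α` of `P(D)` for the bilinear pairing `∫ f g`. -/
def opDTranspose {n : ℕ} (P : MvPolynomial (Fin n) ℝ) (φ : E n → ℂ) : E n → ℂ :=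
  fun x => ∑ α ∈ P.support, (-1 : ℂ) ^ (∑ j, α j) * ((P.coeff α : ℝ) : ℂ) * DPow α φ x

/-- The value `P(ξ)` of the symbol. -/
def symbol {n : ℕ} (P : MvPolynomial (Fin n) ℝ) (ξ : E n) : ℝ :=
  MvPolynomial.eval (fun j => ξ j) P

/-- `∂^α P`, for a multi-index `α`. -/
def derivPoly {n : ℕ} (P : MvPolynomial (Fin n) ℝ) (α : Fin n → ℕ) : MvPolynomial (Fin n) ℝ :=
  (List.finRange n).foldr (fun j Q => (fun R => MvPolynomial.pderiv j R)^[α j] Q) P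

/-- `P̃(ξ) = (∑_α |P^{(α)}(ξ)|²)^{1/2}`. Multi-indices with an entry above the total degree of `P`
are left out, since the corresponding derivatives of `P` are zero. -/
def symbolTilde {n : ℕ} (P : MvPolynomial (Fin n) ℝ) (ξ : E n) : ℝ :=
  Real.sqrt (∑ α : Fin n → Fin (P.totalDegree + 1),
    symbol (derivPoly P (fun j => (α j : ℕ))) ξ ^ 2)

/-- One of the symbols `P` and `-P` is bounded from below on `ℝⁿ`. -/
def SemiboundedSymbol {n : ℕ} (P : MvPolynomial (Fin n) ℝ) : Prop :=
  (∃ C : ℝ, ∀ ξ : E n, C ≤ symbol P ξ) ∨ (∃ C : ℝ, ∀ ξ : E n, C ≤ -symbol P ξ)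

/-- The support of a function regarded as a distribution (almost everywhere class): the complement
of the largest open set on which it vanishes almost everywhere. -/
def essSupport {n : ℕ} (V : E n → ℝ) : Set (E n) :=
  {x | ∀ U ∈ 𝓝 x, ¬ V =ᵐ[volume.restrict U] 0}

/-- `L²(Ω)`. -/
abbrev L2 {n : ℕ} (Ω : TopologicalSpace.Opens (E n)) : Type :=
  Lp ℂ 2 ((volume : Measure (E n)).restrict (Ω : Set (E n)))

/-- The space `H_0^{P}(Ω)`: the completion of `C_0^∞(Ω)` for the norm `‖P(D)φ‖_{L²}`, realised as a
space of functions. Because `‖φ‖ ≤ C_Ω ‖P(D)φ‖` on `C_0^∞(Ω)` for bounded `Ω`, a sequence of test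
functions that is Cauchy for this norm has an `L²(Ω)` limit `u`, and its elements are such limits.
An element is recorded as the pair `(u, P(D)u)`, so that the space is the closure in
`L²(Ω) × L²(Ω)` of the graph of `P(D)` on test functions and the norm of `p` is `‖p.2‖`. -/
def H0 {n : ℕ} (P : MvPolynomial (Fin n) ℝ) (Ω : TopologicalSpace.Opens (E n)) :
    Set (L2 Ω × L2 Ω) :=
  closure {p | ∃ φ : 𝓓(Ω, ℂ),
    p.1 =ᵐ[volume.restrict (Ω : Set (E n))] φ ∧
    p.2 =ᵐ[volume.restrict (Ω : Set (E n))] opD P φ}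

/-- The form `B_λ(u,v) = ⟨V⁻¹ (P(D) - λ) u, (P(D) + V - λ) v⟩_{L²(Ω)}`, for real `λ`, on pairs
`u = (u, P(D)u)`, `v = (v, P(D)v)` in `H_0^P(Ω)`. -/
def B {n : ℕ} (V : E n → ℝ) (Ω : TopologicalSpace.Opens (E n)) (lam : ℝ) (u v : L2 Ω × L2 Ω) : ℂ :=
  ∫ x in (Ω : Set (E n)), ((1 / V x : ℝ) : ℂ) * (u.2 x - (lam : ℂ) * u.1 x) *
    (starRingEnd ℂ) (v.2 x + (V x : ℂ) * v.1 x - (lam : ℂ) * v.1 x)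

/-- `B_λ` is coercive on `H_0^P(Ω)`: `B_λ(u,u) ≥ c ‖P(D)u‖²` for some `c > 0`. -/
def IsCoerciveAt {n : ℕ} (P : MvPolynomial (Fin n) ℝ) (V : E n → ℝ)
    (Ω : TopologicalSpace.Opens (E n)) (lam : ℝ) : Prop :=
  ∃ c : ℝ, 0 < c ∧ ∀ u ∈ H0 P Ω, c * ‖u.2‖ ^ 2 ≤ (B V Ω lam u u).re

/-- `v ∈ L²_loc(Ω)`. -/
def MemL2Loc {n : ℕ} (Ω : TopologicalSpace.Opens (E n)) (v : E n → ℂ) : Prop :=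
  ∀ K : Set (E n), IsCompact K → K ⊆ (Ω : Set (E n)) → MemLp v 2 (volume.restrict K)

/-- `(P(D) + W - λ) v = 0` in `𝓓'(Ω)`. -/
def SolvesWeakly {n : ℕ} (P : MvPolynomial (Fin n) ℝ) (W : E n → ℝ)
    (Ω : TopologicalSpace.Opens (E n)) (lam : ℂ) (v : E n → ℂ) : Prop :=
  ∀ φ : 𝓓(Ω, ℂ), ∫ x in (Ω : Set (E n)),
    v x * (opDTranspose P φ x + (W x : ℂ) * φ x - lam * φ x) = 0

/-- `λ ∈ ℂ` is a transmission eigenvalue: there are nonzero `v, w ∈ L²_loc(Ω)` with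
`(P(D) - λ) v = 0` and `(P(D) + V - λ) w = 0` in `Ω` and `v - w ∈ H_0^P(Ω)`. -/
def IsTransmissionEigenvalue {n : ℕ} (P : MvPolynomial (Fin n) ℝ) (V : E n → ℝ)
    (Ω : TopologicalSpace.Opens (E n)) (lam : ℂ) : Prop :=
  ∃ v w : E n → ℂ, MemL2Loc Ω v ∧ MemL2Loc Ω w ∧
    ¬ v =ᵐ[volume.restrict (Ω : Set (E n))] 0 ∧
    ¬ w =ᵐ[volume.restrict (Ω : Set (E n))] 0 ∧
    SolvesWeakly P (fun _ => 0) Ω lam v ∧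
    SolvesWeakly P V Ω lam w ∧
    ∃ u ∈ H0 P Ω, u.1 =ᵐ[volume.restrict (Ω : Set (E n))] fun x => v x - w x

end ITP

end

noncomputable section

namespace ITP

open SchwartzMap
open scoped SchwartzMap FourierTransform ComplexConjugate

variable {n : ℕ}

/-! Since `V⁻¹ V = 1`, `B_λ(u,v) = ⟨V⁻¹(P-λ)u, (P-λ)v⟩ + ⟨(P-λ)u, v⟩`, which is a Hermitian form on
`H_0^P(Ω)`. If `u ≠ 0` lies in its kernel, then `w = V⁻¹(P-λ)u` and `v = u + w` solve the
transmission problem (`isTransmissionEigenvalue_of_form_eq_zero`). Neither vanishes: otherwise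
`|(P-λ)u| ≤ (sup V)|u|` almost everywhere, which a Carleman estimate with weight `e^{τ x_j}` rules
out (`eq_zero_of_norm_sub_le`).

A kernel is found by a variational argument (`exists_kernel`). On the segment from `λ₀` to `λ`, take
the infimum `σ` of the parameters at which the form is nonpositive on some unit vector. There the
form is nonnegative with infimum zero on the unit sphere. A Gårding inequality and the compact
embedding `H_0^P(Ω) → L²(Ω)` make a minimising sequence converge, and a null vector of a nonnegative
Hermitian form is in its kernel. Coercivity at `λ₀` keeps `σ` away from `λ₀`.

The analysis rests on Hörmander's inequality `‖(∂_jQ)(D)f‖ ≤ C‖Q(D)f‖` for `f` supported in a fixed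
ball (`nrm_Op_pderiv_le`). Its constant ignores translations of `Q`, so differentiating `P(ξ +
iτe_j)` down to degree one yields the Carleman estimate. Applied to all derivatives of `P`, it
bounds `P̃(ξ) 𝓕 f` in `L²`; as `P̃ → ∞`, Fourier tails are uniformly small, whence compactness
(`exists_cauchySeq_fst`).

For (i), choose `λ₀` with `|P(ξ) - λ₀| ≥ K > sup V`; by Plancherel the first term of the form then
dominates the second. -/

/-! ### Operators `Q(D)` as Fourier multipliers on Schwartz functions. -/

/-- The value `Q(2πξ)` of a complex polynomial. -/
def polySymbol (Q : MvPolynomial (Fin n) ℂ) (ξ : E n) : ℂ :=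
  MvPolynomial.eval (fun j => ((2 * Real.pi * ξ j : ℝ) : ℂ)) Q

theorem hasTemperateGrowth_coord (j : Fin n) : (fun x : E n => x j).HasTemperateGrowth :=
  (EuclideanSpace.proj (𝕜 := ℝ) j).hasTemperateGrowth

theorem hasTemperateGrowth_coord_ofReal (j : Fin n) :
    (fun x : E n => ((x j : ℝ) : ℂ)).HasTemperateGrowth :=
  Function.HasTemperateGrowth.comp (g := Complex.ofReal)
    Complex.ofRealCLM.hasTemperateGrowth
    (hasTemperateGrowth_coord j)

theorem hasTemperateGrowth_polySymbol (Q : MvPolynomial (Fin n) ℂ) :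
    (polySymbol Q).HasTemperateGrowth := by
  induction Q using MvPolynomial.induction_on with
  | C a =>
    have : polySymbol (n := n) (MvPolynomial.C a) = fun _ => a := by ext; simp [polySymbol]
    rw [this]; exact .const a
  | add p q hp hq =>
    have : polySymbol (p + q) = polySymbol p + polySymbol q := by ext; simp [polySymbol]
    rw [this]; exact hp.add hq
  | mul_X p j hp =>
    have : polySymbol (p * MvPolynomial.X j) =
        polySymbol p * ((fun _ => ((2 * Real.pi : ℝ) : ℂ)) * fun x : E n => ((x j : ℝ) : ℂ)) := by
      ext; simp [polySymbol]
    rw [this]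
    exact hp.mul ((Function.HasTemperateGrowth.const _).mul (hasTemperateGrowth_coord_ofReal j))

/-- The operator `Q(D)` on Schwartz functions, as a Fourier multiplier. -/
def Op (Q : MvPolynomial (Fin n) ℂ) : 𝓢(E n, ℂ) →L[ℂ] 𝓢(E n, ℂ) :=
  fourierMultiplierCLM ℂ (polySymbol Q)

theorem fourier_Op (Q : MvPolynomial (Fin n) ℂ) (f : 𝓢(E n, ℂ)) (ξ : E n) :
    𝓕 (Op Q f) ξ = polySymbol Q ξ * 𝓕 f ξ := by
  have h : 𝓕 (Op Q f) = smulLeftCLM ℂ (polySymbol Q) (𝓕 f) := by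
    simp [Op, fourierMultiplierCLM_apply]
  rw [h, smulLeftCLM_apply_apply (hasTemperateGrowth_polySymbol Q), smul_eq_mul]

/-- Reduces identities between constant coefficient operators to pointwise identities between
symbols. -/
theorem fourier_injective {f g : 𝓢(E n, ℂ)} (h : ∀ ξ, 𝓕 f ξ = 𝓕 g ξ) : f = g := by
  have h' : 𝓕 f = 𝓕 g := SchwartzMap.ext h
  rw [← FourierTransform.fourierInv_fourier_eq (F := 𝓢(E n, ℂ)) f, h',
    FourierTransform.fourierInv_fourier_eq]

theorem fourier_add_apply (f g : 𝓢(E n, ℂ)) (ξ : E n) : 𝓕 (f + g) ξ = 𝓕 f ξ + 𝓕 g ξ := by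
  rw [FourierTransform.fourier_add]; rfl

theorem fourier_smul_apply (a : ℂ) (f : 𝓢(E n, ℂ)) (ξ : E n) : 𝓕 (a • f) ξ = a * 𝓕 f ξ := by
  rw [FourierTransform.fourier_smul]; rfl

theorem Op_mul (p q : MvPolynomial (Fin n) ℂ) (f : 𝓢(E n, ℂ)) : Op (p * q) f = Op p (Op q f) :=
  fourier_injective fun ξ => by simp only [fourier_Op, polySymbol, map_mul]; ring

theorem Op_add (p q : MvPolynomial (Fin n) ℂ) (f : 𝓢(E n, ℂ)) :
    Op (p + q) f = Op p f + Op q f :=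
  fourier_injective fun ξ => by simp only [fourier_add_apply, fourier_Op, polySymbol, map_add]; ring

theorem Op_C (a : ℂ) (f : 𝓢(E n, ℂ)) : Op (MvPolynomial.C a) f = a • f :=
  fourier_injective fun ξ => by simp [fourier_Op, polySymbol]

theorem Op_one (f : 𝓢(E n, ℂ)) : Op 1 f = f := by
  rw [← MvPolynomial.C_1, Op_C, one_smul]

theorem Op_sum {ι : Type*} (s : Finset ι) (p : ι → MvPolynomial (Fin n) ℂ) (f : 𝓢(E n, ℂ)) :
    Op (∑ i ∈ s, p i) f = ∑ i ∈ s, Op (p i) f := by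
  classical
  induction s using Finset.induction_on with
  | empty => simpa using Op_C (n := n) 0 f
  | insert i s hi ih => rw [Finset.sum_insert hi, Finset.sum_insert hi, Op_add, ih]

theorem Op_X (j : Fin n) (f : 𝓢(E n, ℂ)) : ⇑(Op (MvPolynomial.X j) f) = D j f := by
  have : Op (MvPolynomial.X j) f =
      (-Complex.I) • LineDeriv.lineDerivOp (EuclideanSpace.single j (1 : ℝ) : E n) f := by
    refine fourier_injective fun ξ => ?_
    rw [fourier_smul_apply, fourier_Op, SchwartzMap.fourier_lineDerivOp_eq]
    rw [smul_apply, smulLeftCLM_apply_apply (by fun_prop)]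
    simp [polySymbol, EuclideanSpace.inner_single_right]
    ring_nf
    simp
  ext x
  rw [this]
  simp [D, SchwartzMap.lineDerivOp_apply_eq_fderiv]

/-- Locality is invisible in the multiplier definition; it comes from building `Q(D)` out of scalars
and the derivatives `D_j`. -/
theorem tsupport_Op_subset (Q : MvPolynomial (Fin n) ℂ) (f : 𝓢(E n, ℂ)) :
    tsupport (Op Q f) ⊆ tsupport f := by
  induction Q using MvPolynomial.induction_on generalizing f with
  | C a =>
    rw [Op_C]
    exact tsupport_smul_subset_right (fun _ => a) f
  | add p q hp hq =>
    rw [Op_add]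
    exact (tsupport_add (Op p f) (Op q f)).trans (Set.union_subset (hp f) (hq f))
  | mul_X p j hp =>
    rw [Op_mul]
    refine (hp _).trans ?_
    rw [Op_X]
    refine (tsupport_mul_subset_right (f := fun _ => -Complex.I)).trans ?_
    exact tsupport_fderiv_apply_subset ℝ _

/-! ### Commutation with coordinate functions. -/

/-- Multiplication by the coordinate `x_j` on Schwartz functions. -/
def mulCoord (j : Fin n) : 𝓢(E n, ℂ) →L[ℂ] 𝓢(E n, ℂ) :=
  smulLeftCLM ℂ fun x : E n => ((x j : ℝ) : ℂ)

theorem mulCoord_apply (j : Fin n) (f : 𝓢(E n, ℂ)) (x : E n) :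
    mulCoord j f x = (x j : ℂ) * f x :=
  smulLeftCLM_apply_apply (hasTemperateGrowth_coord_ofReal j) f x

theorem Op_X_mulCoord (i j : Fin n) (f : 𝓢(E n, ℂ)) :
    Op (MvPolynomial.X i) (mulCoord j f) =
      mulCoord j (Op (MvPolynomial.X i) f) - (if i = j then Complex.I else 0) • f := by
  ext x
  have h1 : HasFDerivAt (fun x : E n => ((x j : ℝ) : ℂ))
      (Complex.ofRealCLM.comp (EuclideanSpace.proj (𝕜 := ℝ) j)) x :=
    (Complex.ofRealCLM.comp (EuclideanSpace.proj (𝕜 := ℝ) j : E n →L[ℝ] ℝ)).hasFDerivAt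
  have h2 : HasFDerivAt (fun x : E n => (x j : ℂ) * f x) _ x := h1.mul (f.hasFDerivAt x)
  have h3 : ⇑(mulCoord j f) = fun x => (x j : ℂ) * f x := funext (mulCoord_apply j f)
  rw [sub_apply, mulCoord_apply, Op_X, Op_X, D, D, h3, h2.fderiv, smul_apply]
  by_cases hij : i = j
  · subst hij; simp; ring
  · simp [hij, Ne.symm hij]; ring

/-- `Q(D)(x_j f) = x_j Q(D) f - i (∂_j Q)(D) f`. -/
theorem Op_mulCoord (Q : MvPolynomial (Fin n) ℂ) (j : Fin n) (f : 𝓢(E n, ℂ)) :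
    Op Q (mulCoord j f) =
      mulCoord j (Op Q f) - Complex.I • Op (MvPolynomial.pderiv j Q) f := by
  induction Q using MvPolynomial.induction_on generalizing f with
  | C a =>
    have : Op (0 : MvPolynomial (Fin n) ℂ) f = 0 := by simpa using Op_C (n := n) 0 f
    simp [Op_C, this]
  | add p q hp hq =>
    simp only [Op_add, hp, hq, map_add, smul_add]; abel
  | mul_X p i hp =>
    rw [Op_mul, Op_X_mulCoord, map_sub, hp, map_smul, Derivation.leibniz, Op_add, smul_eq_mul,
      smul_eq_mul, MvPolynomial.pderiv_X, Op_mul p, mul_comm (MvPolynomial.X i),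
      Op_mul _ (MvPolynomial.X i)]
    by_cases hij : i = j
    · subst hij; simp; abel
    · have : Op (0 : MvPolynomial (Fin n) ℂ) f = 0 := by simpa using Op_C (n := n) 0 f
      simp [hij, this]

/-! ### Plancherel estimates in `L²`. -/

/-- The inclusion of Schwartz functions in `L²`. -/
def toL2 : 𝓢(E n, ℂ) →L[ℂ] Lp ℂ 2 (volume : Measure (E n)) := toLpCLM ℂ ℂ 2 volume

theorem toL2_apply (f : 𝓢(E n, ℂ)) : toL2 f = f.toLp 2 (volume : Measure (E n)) := rfl

theorem coeFn_toL2 (f : 𝓢(E n, ℂ)) : toL2 f =ᵐ[volume] f := f.coeFn_toLp 2 volume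

/-- The `L²` norm of a Schwartz function. -/
def nrm (f : 𝓢(E n, ℂ)) : ℝ := ‖toL2 f‖

theorem nrm_nonneg (f : 𝓢(E n, ℂ)) : 0 ≤ nrm f := norm_nonneg _

theorem nrm_sq (f : 𝓢(E n, ℂ)) : nrm f ^ 2 = ∫ x, ‖f x‖ ^ 2 := by
  have h := inner_toL2_toL2_eq f f (volume : Measure (E n))
  rw [inner_self_eq_norm_sq_to_K] at h
  have h2 : ∀ x, inner ℂ (f x) (f x) = ((‖f x‖ ^ 2 : ℝ) : ℂ) := fun x => by
    rw [inner_self_eq_norm_sq_to_K]; simp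
  simp_rw [h2] at h
  rw [integral_complex_ofReal] at h
  rw [nrm, toL2_apply]
  exact Complex.ofReal_injective (by rw [← h]; simp)

theorem integrable_norm_sq (f : 𝓢(E n, ℂ)) : Integrable (fun x => ‖f x‖ ^ 2) :=
  (f.memLp 2).integrable_norm_pow (by norm_num)

theorem nrm_fourier (f : 𝓢(E n, ℂ)) : nrm (𝓕 f) = nrm f := norm_fourier_toL2_eq f

theorem nrm_le_of_norm_le {f g : 𝓢(E n, ℂ)} {c : ℝ} (hc : 0 ≤ c) (h : ∀ x, ‖f x‖ ≤ c * ‖g x‖) :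
    nrm f ≤ c * nrm g := by
  refine le_of_sq_le_sq ?_ (mul_nonneg hc (nrm_nonneg g))
  rw [mul_pow, nrm_sq, nrm_sq, ← integral_const_mul]
  refine integral_mono (integrable_norm_sq f) ((integrable_norm_sq g).const_mul _) fun x => ?_
  have := pow_le_pow_left₀ (norm_nonneg _) (h x) 2
  rwa [mul_pow] at this

theorem nrm_Op_le {p q : MvPolynomial (Fin n) ℂ} {c : ℝ} (hc : 0 ≤ c)
    (h : ∀ ξ, ‖polySymbol p ξ‖ ≤ c * ‖polySymbol q ξ‖) (f : 𝓢(E n, ℂ)) :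
    nrm (Op p f) ≤ c * nrm (Op q f) := by
  rw [← nrm_fourier, ← nrm_fourier (Op q f)]
  refine nrm_le_of_norm_le hc fun ξ => ?_
  rw [fourier_Op, fourier_Op, norm_mul, norm_mul, ← mul_assoc]
  exact mul_le_mul_of_nonneg_right (h ξ) (norm_nonneg _)

/-- The polynomial with conjugate coefficients. -/
abbrev conjPoly (Q : MvPolynomial (Fin n) ℂ) : MvPolynomial (Fin n) ℂ :=
  MvPolynomial.map (starRingEnd ℂ) Q

theorem polySymbol_conjPoly (Q : MvPolynomial (Fin n) ℂ) (ξ : E n) :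
    polySymbol (conjPoly Q) ξ = conj (polySymbol Q ξ) := by
  simp only [polySymbol, MvPolynomial.eval_map]
  rw [MvPolynomial.eval, MvPolynomial.coe_eval₂Hom, MvPolynomial.hom_eval₂]
  simp only [Complex.conj_ofReal, RingHomCompTriple.comp_eq]

theorem nrm_Op_conjPoly (Q : MvPolynomial (Fin n) ℂ) (f : 𝓢(E n, ℂ)) :
    nrm (Op (conjPoly Q) f) = nrm (Op Q f) :=
  le_antisymm
    (by simpa using nrm_Op_le (p := conjPoly Q) (q := Q) zero_le_one
          (fun ξ => by simp [polySymbol_conjPoly]) f)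
    (by simpa using nrm_Op_le (p := Q) (q := conjPoly Q) zero_le_one
          (fun ξ => by simp [polySymbol_conjPoly]) f)

/-- By Plancherel the adjoint of a multiplier has the conjugate symbol. Complex coefficients are
needed because the Carleman argument shifts `ξ` by imaginary vectors. -/
theorem inner_Op (Q : MvPolynomial (Fin n) ℂ) (f g : 𝓢(E n, ℂ)) :
    inner ℂ (toL2 (Op Q f)) (toL2 g) = inner ℂ (toL2 f) (toL2 (Op (conjPoly Q) g)) := by
  simp only [toL2_apply]
  rw [← inner_fourier_toL2_eq, ← inner_fourier_toL2_eq f, inner_toL2_toL2_eq _ _ volume,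
    inner_toL2_toL2_eq _ _ volume]
  refine integral_congr_ae (ae_of_all _ fun ξ => ?_)
  simp only [RCLike.inner_apply, fourier_Op, polySymbol_conjPoly, map_mul]
  ring

theorem nrm_mulCoord_le {R : ℝ} (hR : 0 ≤ R) (j : Fin n) {f : 𝓢(E n, ℂ)}
    (hf : tsupport f ⊆ Metric.closedBall 0 R) : nrm (mulCoord j f) ≤ R * nrm f := by
  refine nrm_le_of_norm_le hR fun x => ?_
  rw [mulCoord_apply, norm_mul]
  by_cases hx : x ∈ tsupport f
  · refine mul_le_mul_of_nonneg_right ?_ (norm_nonneg _)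
    have h1 := hf hx
    rw [mem_closedBall_zero_iff] at h1
    rw [Complex.norm_real]
    exact (PiLp.norm_apply_le x j).trans h1
  · simp [image_eq_zero_of_notMem_tsupport hx]

/-! ### Hörmander's inequality. -/

theorem totalDegree_pderiv_le {R : Type*} [CommSemiring R] (j : Fin n)
    (Q : MvPolynomial (Fin n) R) :
    (MvPolynomial.pderiv j Q).totalDegree ≤ Q.totalDegree - 1 := by
  refine Finset.sup_le fun m hm => ?_
  rw [MvPolynomial.mem_support_iff, MvPolynomial.coeff_pderiv] at hm
  have h := MvPolynomial.le_totalDegree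
    (MvPolynomial.mem_support_iff.2 (left_ne_zero_of_mul hm))
  rw [Finsupp.sum_add_index' (fun _ => rfl) (fun _ _ _ => rfl), Finsupp.sum_single_index rfl] at h
  omega

theorem Op_zero (f : 𝓢(E n, ℂ)) : Op 0 f = 0 := by simpa using Op_C (n := n) 0 f

theorem nrm_zero : nrm (0 : 𝓢(E n, ℂ)) = 0 := by rw [nrm, map_zero, norm_zero]

theorem nrm_sub_le (f g : 𝓢(E n, ℂ)) : nrm (f - g) ≤ nrm f + nrm g := by
  simpa only [nrm, map_sub] using norm_sub_le (toL2 f) (toL2 g)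

theorem nrm_smul (a : ℂ) (f : 𝓢(E n, ℂ)) : nrm (a • f) = ‖a‖ * nrm f := by
  simpa only [nrm, map_smul] using norm_smul a (toL2 f)

theorem norm_inner_toL2_le (f g : 𝓢(E n, ℂ)) : ‖inner ℂ (toL2 f) (toL2 g)‖ ≤ nrm f * nrm g :=
  norm_inner_le_norm _ _

theorem conjPoly_conjPoly (Q : MvPolynomial (Fin n) ℂ) : conjPoly (conjPoly Q) = Q := by
  ext m; simp [conjPoly, MvPolynomial.coeff_map]

/-- Multipliers commute with one another and with adjoints, so each operator can be moved to the
opposite factor, as its adjoint, before Cauchy–Schwarz. -/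
theorem norm_inner_Op_Op (p q : MvPolynomial (Fin n) ℂ) (f g : 𝓢(E n, ℂ)) :
    ‖inner ℂ (toL2 (Op p f)) (toL2 (Op q g))‖ ≤
      nrm (Op (conjPoly p) g) * nrm (Op (conjPoly q) f) := by
  have h : inner ℂ (toL2 (Op p f)) (toL2 (Op q g)) =
      inner ℂ (toL2 (Op (conjPoly q) f)) (toL2 (Op (conjPoly p) g)) := by
    rw [inner_Op p, ← Op_mul, mul_comm, Op_mul, inner_Op (conjPoly q), conjPoly_conjPoly]
  rw [h, mul_comm]
  exact norm_inner_toL2_le _ _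

/-- Pair the commutator identity `i Q'(D)f = x_j Q(D)f - Q(D)(x_j f)` with `Q'(D)f`. In the last
term, swapping the operators leaves the adjoint of `Q(D)` on `f` and that of `Q'(D)` on `x_j f`; a
second commutation produces `Q''`. -/
theorem nrm_Op_pderiv_mul_self_le {R : ℝ} (hR : 0 ≤ R) (j : Fin n) (Q : MvPolynomial (Fin n) ℂ)
    {f : 𝓢(E n, ℂ)} (hf : tsupport f ⊆ Metric.closedBall 0 R) :
    nrm (Op (MvPolynomial.pderiv j Q) f) * nrm (Op (MvPolynomial.pderiv j Q) f) ≤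
      nrm (Op (MvPolynomial.pderiv j Q) f) * (R * nrm (Op Q f)) +
      (R * nrm (Op (MvPolynomial.pderiv j Q) f) +
        nrm (Op (MvPolynomial.pderiv j (MvPolynomial.pderiv j Q)) f)) * nrm (Op Q f) := by
  set Q' := MvPolynomial.pderiv j Q
  have e1 : Complex.I • Op Q' f = mulCoord j (Op Q f) - Op Q (mulCoord j f) := by
    rw [Op_mulCoord]; abel
  have e2 : inner ℂ (toL2 (Op Q' f)) (toL2 (Complex.I • Op Q' f)) =
      inner ℂ (toL2 (Op Q' f)) (toL2 (mulCoord j (Op Q f))) -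
        inner ℂ (toL2 (Op Q' f)) (toL2 (Op Q (mulCoord j f))) := by
    rw [e1, map_sub, inner_sub_right]
  have e3 : ‖inner ℂ (toL2 (Op Q' f)) (toL2 (Complex.I • Op Q' f))‖ =
      nrm (Op Q' f) * nrm (Op Q' f) := by
    rw [map_smul, inner_smul_right, norm_mul, Complex.norm_I, one_mul,
      inner_self_eq_norm_sq_to_K, norm_pow, sq]
    simp [nrm]
  have e4 := nrm_mulCoord_le hR j ((tsupport_Op_subset Q f).trans hf)
  have e5 : nrm (Op (conjPoly Q') (mulCoord j f)) ≤
      R * nrm (Op Q' f) + nrm (Op (MvPolynomial.pderiv j Q') f) := by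
    rw [Op_mulCoord]
    refine (nrm_sub_le _ _).trans (add_le_add ?_ ?_)
    · refine (nrm_mulCoord_le hR j ((tsupport_Op_subset _ f).trans hf)).trans ?_
      rw [nrm_Op_conjPoly]
    · rw [nrm_smul, Complex.norm_I, one_mul, MvPolynomial.pderiv_map, nrm_Op_conjPoly]
  rw [← e3, e2]
  refine (norm_sub_le _ _).trans (add_le_add ((norm_inner_toL2_le _ _).trans ?_)
    ((norm_inner_Op_Op _ _ _ _).trans ?_))
  · exact mul_le_mul_of_nonneg_left e4 (nrm_nonneg _)
  · rw [nrm_Op_conjPoly Q]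
    exact mul_le_mul_of_nonneg_right e5 (nrm_nonneg _)

/-- **Hörmander's inequality** `‖(∂_j Q)(D) f‖ ≤ 2 d R ‖Q(D) f‖` for `f` supported in the ball of
radius `R` and `Q` with `∂_j^d Q = 0`. -/
theorem nrm_Op_pderiv_le {R : ℝ} (hR : 0 ≤ R) (j : Fin n) (d : ℕ) (Q : MvPolynomial (Fin n) ℂ)
    (hQ : (⇑(MvPolynomial.pderiv j))^[d] Q = 0) {f : 𝓢(E n, ℂ)}
    (hf : tsupport f ⊆ Metric.closedBall 0 R) :
    nrm (Op (MvPolynomial.pderiv j Q) f) ≤ 2 * d * R * nrm (Op Q f) := by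
  induction d generalizing Q with
  | zero =>
    have hQ0 : Q = 0 := hQ
    rw [hQ0, map_zero, Op_zero, nrm_zero]
    simp
  | succ d ih =>
    have h1 := ih (MvPolynomial.pderiv j Q) hQ
    have h2 := nrm_Op_pderiv_mul_self_le hR j Q hf
    have ha : 0 ≤ nrm (Op Q f) := nrm_nonneg _
    have hb : 0 ≤ nrm (Op (MvPolynomial.pderiv j Q) f) := nrm_nonneg _
    generalize nrm (Op Q f) = a at *
    generalize nrm (Op (MvPolynomial.pderiv j Q) f) = b at *
    generalize nrm (Op (MvPolynomial.pderiv j (MvPolynomial.pderiv j Q)) f) = e at *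
    rcases hb.eq_or_lt with hb0 | hb1
    · rw [← hb0]; positivity
    -- The induction hypothesis reads `e ≤ 2dRb`, so `b² ≤ 2Rab + ea ≤ 2(d+1)Rab`; divide by `b`.
    · refine le_of_mul_le_mul_left ?_ hb1
      have := mul_le_mul_of_nonneg_right h1 ha
      push_cast
      linarith

theorem iterate_pderiv_eq_zero {R : Type*} [CommSemiring R] (j : Fin n) (d : ℕ)
    (Q : MvPolynomial (Fin n) R) (hQ : Q.totalDegree < d) :
    (⇑(MvPolynomial.pderiv j))^[d] Q = 0 := by
  induction d generalizing Q with
  | zero => omega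
  | succ d ih =>
    rw [Function.iterate_succ_apply]
    by_cases h : Q.totalDegree = 0
    · rw [MvPolynomial.totalDegree_eq_zero_iff_eq_C] at h
      rw [h, MvPolynomial.pderiv_C]
      exact iterate_map_zero (MvPolynomial.pderiv (R := R) j) d
    · exact ih _ (lt_of_le_of_lt (totalDegree_pderiv_le j Q) (by omega))

/-! ### Exponential weights and the Carleman bound. -/

/-- A real polynomial with its coefficients regarded as complex numbers. -/
abbrev complexify (P : MvPolynomial (Fin n) ℝ) : MvPolynomial (Fin n) ℂ :=
  MvPolynomial.map Complex.ofRealHom P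

/-- The translate `Q(ξ + s e_j)`. -/
def shift (s : ℂ) (j : Fin n) : MvPolynomial (Fin n) ℂ →ₐ[ℂ] MvPolynomial (Fin n) ℂ :=
  MvPolynomial.aeval fun k => MvPolynomial.X k + MvPolynomial.C (if k = j then s else 0)

theorem shift_X (s : ℂ) (j k : Fin n) : shift s j (MvPolynomial.X k) =
    MvPolynomial.X k + MvPolynomial.C (if k = j then s else 0) :=
  MvPolynomial.aeval_X _ k

theorem shift_C (s : ℂ) (j : Fin n) (a : ℂ) : shift s j (MvPolynomial.C a) = MvPolynomial.C a :=
  MvPolynomial.aeval_C _ a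

theorem pderiv_shift (s : ℂ) (i j : Fin n) (Q : MvPolynomial (Fin n) ℂ) :
    MvPolynomial.pderiv i (shift s j Q) = shift s j (MvPolynomial.pderiv i Q) := by
  induction Q using MvPolynomial.induction_on with
  | C a => simp
  | add p q hp hq => simp [hp, hq]
  | mul_X p k hp =>
    rw [map_mul, Derivation.leibniz, Derivation.leibniz, hp, shift_X]
    by_cases h : k = i
    · subst h; simp [shift_X]
    · simp [h, shift_X]

theorem iterate_pderiv_shift (s : ℂ) (i j : Fin n) (d : ℕ) (Q : MvPolynomial (Fin n) ℂ) :
    (⇑(MvPolynomial.pderiv i))^[d] (shift s j Q) =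
      shift s j ((⇑(MvPolynomial.pderiv i))^[d] Q) := by
  induction d generalizing Q with
  | zero => rfl
  | succ d ih => rw [Function.iterate_succ_apply, Function.iterate_succ_apply, pderiv_shift, ih]

/-- Conjugation of `Q(D)` by the weight `e^{τ x_j}` gives `Q(D + iτ e_j)`. -/
theorem Op_shift_exp (τ : ℝ) (j : Fin n) (Q : MvPolynomial (Fin n) ℂ) (f g : 𝓢(E n, ℂ))
    (hfg : ∀ x, g x = (Real.exp (τ * x j) : ℂ) * f x) (x : E n) :
    Op (shift (Complex.I * τ) j Q) g x = (Real.exp (τ * x j) : ℂ) * Op Q f x := by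
  induction Q using MvPolynomial.induction_on generalizing f g x with
  | C a => rw [shift_C, Op_C, Op_C, smul_apply, smul_apply, hfg]; simp; ring
  | add p q hp hq =>
    rw [map_add, Op_add, Op_add, add_apply, add_apply, hp f g hfg, hq f g hfg]; ring
  | mul_X p k hp =>
    rw [map_mul, Op_mul, Op_mul]
    -- Only the degree-one case remains: `D_j` falling on the weight gives `-iτ`, which the shift
    -- `iτ` cancels.
    refine hp _ _ (fun x => ?_) x
    have h1 : HasFDerivAt (fun x : E n => ((Real.exp (τ * x j) : ℝ) : ℂ))
        (Complex.ofRealCLM.comp (Real.exp (τ * x j) • (τ • EuclideanSpace.proj (𝕜 := ℝ) j))) x :=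
      Complex.ofRealCLM.hasFDerivAt.comp x
        (((EuclideanSpace.proj (𝕜 := ℝ) j : E n →L[ℝ] ℝ).hasFDerivAt.const_mul τ).exp)
    have h2 : HasFDerivAt (fun x : E n => ((Real.exp (τ * x j) : ℝ) : ℂ) * f x) _ x :=
      h1.mul (f.hasFDerivAt x)
    have h3 : ⇑g = fun x => (Real.exp (τ * x j) : ℂ) * f x := funext hfg
    rw [shift_X, Op_add, Op_C, add_apply, smul_apply, Op_X, Op_X, D, D]
    rw [h3, h2.fderiv]
    by_cases hk : k = j
    · subst hk; simp; ring
    · simp [hk, Ne.symm hk]; ring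

theorem polySymbol_shift_complexify (s : ℂ) (j : Fin n) (P : MvPolynomial (Fin n) ℝ) (ξ : E n) :
    polySymbol (shift s j (complexify P)) ξ = ∑ α ∈ P.support, ((P.coeff α : ℝ) : ℂ) *
      ∏ k, (((2 * Real.pi * ξ k : ℝ) : ℂ) + if k = j then s else 0) ^ α k := by
  have h : polySymbol (shift s j (complexify P)) ξ = MvPolynomial.eval
      (fun k => ((2 * Real.pi * ξ k : ℝ) : ℂ) + if k = j then s else 0) (complexify P) := by
    generalize complexify P = Q
    induction Q using MvPolynomial.induction_on with
    | C a => simp [polySymbol]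
    | add p q hp hq => simp only [polySymbol, map_add] at *; rw [hp, hq]
    | mul_X p k hp => simp only [polySymbol, map_mul] at *; rw [hp, shift_X]; simp
  rw [h, complexify, MvPolynomial.eval_map, MvPolynomial.eval₂_eq']
  rfl

/-- A real affine symbol is real on real arguments, so its imaginary part after the shift is just
the `j`-th slope times `τ`. -/
theorem im_polySymbol_shift {P : MvPolynomial (Fin n) ℝ} (hP : P.totalDegree ≤ 1) (j : Fin n)
    (τ : ℝ) (ξ : E n) :
    (polySymbol (shift (Complex.I * τ) j (complexify P)) ξ).im =
      P.coeff (Finsupp.single j 1) * τ := by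
  have hα : ∀ α ∈ P.support, (((P.coeff α : ℝ) : ℂ) * ∏ k, (((2 * Real.pi * ξ k : ℝ) : ℂ) +
      if k = j then Complex.I * τ else 0) ^ α k).im =
      if α = Finsupp.single j 1 then P.coeff α * τ else 0 := by
    intro α hα
    have h1 := (MvPolynomial.le_totalDegree hα).trans hP
    rcases Nat.le_one_iff_eq_zero_or_eq_one.1 h1 with h | h
    · have h0 : α = 0 := by
        ext k
        by_contra hk
        have := Finset.sum_eq_zero_iff.1 h k (Finsupp.mem_support_iff.2 hk)
        exact hk this
      subst h0
      have : ¬ (0 : Fin n →₀ ℕ) = Finsupp.single j 1 := by simp [eq_comm]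
      simp [this]
    · obtain ⟨k, rfl⟩ := (Finsupp.sum_eq_one_iff α).1 h
      rw [Finset.prod_eq_single k (fun b _ hb => by simp [Ne.symm hb]) (by simp)]
      by_cases hk : k = j
      · subst hk; simp
      · have : ¬ Finsupp.single k 1 = Finsupp.single j (1 : ℕ) := fun h => hk
          (Finsupp.single_left_injective one_ne_zero h)
        simp [hk, this]
  rw [polySymbol_shift_complexify, Complex.im_sum, Finset.sum_congr rfl hα, Finset.sum_ite_eq']
  split_ifs with h
  · rfl
  · rw [MvPolynomial.notMem_support_iff.1 h, zero_mul]

theorem exists_mem_support_degree {P : MvPolynomial (Fin n) ℝ} (hP : 1 ≤ P.totalDegree) :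
    ∃ α ∈ P.support, (α.sum fun _ e => e) = P.totalDegree := by
  have hne : P.support.Nonempty := by
    rw [Finset.nonempty_iff_ne_empty, Ne, MvPolynomial.support_eq_empty]
    rintro rfl
    simp at hP
  obtain ⟨α, hα, h⟩ := Finset.exists_mem_eq_sup P.support hne fun s => s.sum fun _ e => e
  exact ⟨α, hα, h.symm⟩

theorem exists_totalDegree_pderiv_eq {P : MvPolynomial (Fin n) ℝ} {d : ℕ}
    (hP : P.totalDegree = d + 1) : ∃ i, (MvPolynomial.pderiv i P).totalDegree = d := by
  obtain ⟨α, hα, hαd⟩ := exists_mem_support_degree (P := P) (by omega)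
  have hαne : ∃ i, α i ≠ 0 := by
    by_contra! h
    have : α = 0 := Finsupp.ext h
    rw [this, Finsupp.sum_zero_index] at hαd
    omega
  obtain ⟨i, hi⟩ := hαne
  have hadd : α - Finsupp.single i 1 + Finsupp.single i 1 = α :=
    tsub_add_cancel_of_le (by simpa [Nat.one_le_iff_ne_zero] using hi)
  have hmem : α - Finsupp.single i 1 ∈ (MvPolynomial.pderiv i P).support := by
    rw [MvPolynomial.mem_support_iff, MvPolynomial.coeff_pderiv, hadd]
    exact mul_ne_zero (MvPolynomial.mem_support_iff.1 hα) (by positivity)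
  have hsum : (α.sum fun _ e => e) = ((α - Finsupp.single i 1).sum fun _ e => e) + 1 := by
    conv_lhs => rw [← hadd]
    rw [Finsupp.sum_add_index' (fun _ => rfl) (fun _ _ _ => rfl), Finsupp.sum_single_index rfl]
  refine ⟨i, le_antisymm ((totalDegree_pderiv_le i P).trans (by omega)) ?_⟩
  have := MvPolynomial.le_totalDegree hmem
  omega

theorem totalDegree_complexify_le (P : MvPolynomial (Fin n) ℝ) :
    (complexify P).totalDegree ≤ P.totalDegree :=
  Finset.sup_mono (MvPolynomial.support_map_subset _ P)

/-- Translation commutes with differentiation and does not affect when iterated derivatives vanish,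
so the constant is independent of `s`. This uniformity lets `τ` tend to infinity. -/
theorem nrm_Op_shift_pderiv_le {R : ℝ} (hR : 0 ≤ R) (i j : Fin n) (s : ℂ)
    (P : MvPolynomial (Fin n) ℝ) {g : 𝓢(E n, ℂ)} (hg : tsupport g ⊆ Metric.closedBall 0 R) :
    nrm (Op (shift s j (complexify (MvPolynomial.pderiv i P))) g) ≤
      2 * (P.totalDegree + 1 : ℕ) * R * nrm (Op (shift s j (complexify P)) g) := by
  have h0 : (⇑(MvPolynomial.pderiv i))^[P.totalDegree + 1] (shift s j (complexify P)) = 0 := by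
    rw [iterate_pderiv_shift, iterate_pderiv_eq_zero i _ _
      (Nat.lt_succ_of_le (totalDegree_complexify_le P)), map_zero]
  have h1 := nrm_Op_pderiv_le hR i _ _ h0 hg
  rwa [pderiv_shift, complexify, MvPolynomial.pderiv_map] at h1

/-- A Carleman type lower bound `c τ ‖g‖ ≤ ‖P(D + iτ e_j) g‖` for functions `g` supported in a fixed
ball. -/
theorem exists_mul_nrm_le_nrm_Op_shift (P : MvPolynomial (Fin n) ℝ) (hP : 1 ≤ P.totalDegree) {R : ℝ}
    (hR : 0 ≤ R) : ∃ j : Fin n, ∃ c : ℝ, 0 < c ∧ ∀ τ : ℝ, 0 ≤ τ → ∀ g : 𝓢(E n, ℂ),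
      tsupport g ⊆ Metric.closedBall 0 R →
        c * τ * nrm g ≤ nrm (Op (shift (Complex.I * τ) j (complexify P)) g) := by
  obtain ⟨d, hd⟩ : ∃ d, P.totalDegree = d + 1 := ⟨P.totalDegree - 1, by omega⟩
  induction d generalizing P with
  | zero =>
    obtain ⟨α, hα, hαd⟩ := exists_mem_support_degree hP
    rw [hd] at hαd
    obtain ⟨j, rfl⟩ := (Finsupp.sum_eq_one_iff α).1 hαd
    have hc : 0 < |P.coeff (Finsupp.single j 1)| := abs_pos.2 (MvPolynomial.mem_support_iff.1 hα)
    -- The direction `j` is chosen here, at degree one, where the imaginary part alone bounds the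
    -- symbol from below by a multiple of `τ`.
    refine ⟨j, _, hc, fun τ hτ g _ => ?_⟩
    rcases hτ.eq_or_lt with rfl | hτ
    · simpa using nrm_nonneg _
    have h := nrm_Op_le (p := 1) (q := shift (Complex.I * τ) j (complexify P))
      (c := (|P.coeff (Finsupp.single j 1)| * τ)⁻¹) (by positivity) (fun ξ => ?_) g
    · rwa [Op_one, inv_mul_eq_div, le_div_iff₀' (by positivity)] at h
    · have h1 := Complex.abs_im_le_norm (polySymbol (shift (Complex.I * τ) j (complexify P)) ξ)
      rw [im_polySymbol_shift hd.le, abs_mul, abs_of_pos hτ] at h1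
      rw [inv_mul_eq_div, le_div_iff₀ (by positivity)]
      simpa [polySymbol] using h1
  | succ d ih =>
    obtain ⟨i, hi⟩ := exists_totalDegree_pderiv_eq hd
    obtain ⟨j, c, hc, h⟩ := ih (MvPolynomial.pderiv i P) (by omega) hi
    -- The `+ 1` keeps the denominator positive when `R = 0`.
    refine ⟨j, c / (2 * (P.totalDegree + 1 : ℕ) * R + 1), by positivity, fun τ hτ g hg => ?_⟩
    have h2 := (h τ hτ g hg).trans (nrm_Op_shift_pderiv_le hR i j (Complex.I * τ) P hg)
    rw [div_mul_eq_mul_div, div_mul_eq_mul_div, div_le_iff₀ (by positivity)]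
    have := nrm_nonneg (Op (shift (Complex.I * τ) j (complexify P)) g)
    linarith

/-- All derivatives of a polynomial are dominated by it on functions supported in a fixed ball. -/
theorem exists_nrm_Op_derivPoly_le (P : MvPolynomial (Fin n) ℝ) {R : ℝ} (hR : 0 ≤ R)
    (α : Fin n → ℕ) : ∃ C : ℝ, 0 ≤ C ∧ ∀ f : 𝓢(E n, ℂ), tsupport f ⊆ Metric.closedBall 0 R →
      nrm (Op (complexify (derivPoly P α)) f) ≤ C * nrm (Op (complexify P) f) := by
  have step : ∀ Q : MvPolynomial (Fin n) ℝ, ∀ j,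
      (∃ C : ℝ, 0 ≤ C ∧ ∀ f : 𝓢(E n, ℂ), tsupport f ⊆ Metric.closedBall 0 R →
        nrm (Op (complexify Q) f) ≤ C * nrm (Op (complexify P) f)) →
      ∃ C : ℝ, 0 ≤ C ∧ ∀ f : 𝓢(E n, ℂ), tsupport f ⊆ Metric.closedBall 0 R →
        nrm (Op (complexify (MvPolynomial.pderiv j Q)) f) ≤ C * nrm (Op (complexify P) f) := by
    rintro Q j ⟨C, hC, h⟩
    refine ⟨2 * ((complexify Q).totalDegree + 1 : ℕ) * R * C, by positivity, fun f hf => ?_⟩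
    have h1 := nrm_Op_pderiv_le hR j _ (complexify Q)
      (iterate_pderiv_eq_zero j _ _ (Nat.lt_succ_self _)) hf
    rw [complexify, ← MvPolynomial.pderiv_map]
    refine h1.trans ?_
    rw [mul_assoc _ C]
    exact mul_le_mul_of_nonneg_left (h f hf) (by positivity)
  unfold derivPoly
  induction List.finRange n with
  | nil => exact ⟨1, zero_le_one, fun f _ => by simp⟩
  | cons j l ih =>
    rw [List.foldr_cons]
    induction α j with
    | zero => exact ih
    | succ k ihk =>
      rw [Function.iterate_succ_apply']
      exact step _ j ihk

/-! ### The differential operators and `H_0^P(Ω)` in terms of multipliers. -/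

theorem iterate_D (j : Fin n) (k : ℕ) (f : 𝓢(E n, ℂ)) :
    (D j)^[k] f = ⇑(Op (MvPolynomial.X j ^ k) f) := by
  induction k with
  | zero => rw [pow_zero, Op_one]; rfl
  | succ k ih => rw [Function.iterate_succ_apply', ih, ← Op_X, ← Op_mul, pow_succ']

theorem DPow_eq_Op (α : Fin n →₀ ℕ) (f : 𝓢(E n, ℂ)) :
    DPow α f = ⇑(Op (MvPolynomial.monomial α 1) f) := by
  have h : ∀ l : List (Fin n), l.foldr (fun j g => (D j)^[α j] g) f =
      ⇑(Op (l.map fun j => (MvPolynomial.X j ^ α j : MvPolynomial (Fin n) ℂ)).prod f) := by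
    intro l
    induction l with
    | nil => rw [List.map_nil, List.prod_nil, Op_one]; rfl
    | cons j l ih => rw [List.foldr_cons, ih, iterate_D, ← Op_mul, List.map_cons, List.prod_cons]
  rw [DPow, h, ← Fin.prod_univ_def, MvPolynomial.monomial_eq, MvPolynomial.C_1, one_mul,
    Finsupp.prod_fintype _ _ fun _ => pow_zero _]

theorem opD_eq_Op (P : MvPolynomial (Fin n) ℝ) (f : 𝓢(E n, ℂ)) :
    opD P f = ⇑(Op (complexify P) f) := by
  have h : complexify P = ∑ α ∈ P.support,
      MvPolynomial.C ((P.coeff α : ℝ) : ℂ) * MvPolynomial.monomial α 1 := by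
    conv_lhs => rw [complexify, P.as_sum, map_sum]
    refine Finset.sum_congr rfl fun α _ => ?_
    rw [MvPolynomial.map_monomial, MvPolynomial.C_mul_monomial, mul_one]
    rfl
  ext x
  rw [h, Op_sum, opD, sum_apply]
  refine Finset.sum_congr rfl fun α _ => ?_
  rw [Op_mul, Op_C, smul_apply, DPow_eq_Op, smul_eq_mul]

/-- Restriction of Schwartz functions to `L²(Ω)`. -/
def res (Ω : TopologicalSpace.Opens (E n)) : 𝓢(E n, ℂ) →L[ℂ] L2 Ω :=
  (LpToLpRestrictCLM (E n) ℂ ℂ volume 2 (Ω : Set (E n))).comp toL2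

theorem coeFn_res (Ω : TopologicalSpace.Opens (E n)) (f : 𝓢(E n, ℂ)) :
    res Ω f =ᵐ[volume.restrict (Ω : Set (E n))] f :=
  (LpToLpRestrictCLM_coeFn ℂ (Ω : Set (E n)) (toL2 f)).trans (ae_restrict_of_ae (coeFn_toL2 f))

theorem norm_res {Ω : TopologicalSpace.Opens (E n)} {f : 𝓢(E n, ℂ)} (hf : tsupport f ⊆ Ω) :
    ‖res Ω f‖ = nrm f := by
  rw [nrm, Lp.norm_def, Lp.norm_def, eLpNorm_congr_ae (coeFn_res Ω f),
    eLpNorm_congr_ae (coeFn_toL2 f),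
    eLpNorm_restrict_eq_of_support_subset ((subset_tsupport f).trans hf)]

theorem inner_res {Ω : TopologicalSpace.Opens (E n)} {f : 𝓢(E n, ℂ)} (hf : tsupport f ⊆ Ω)
    (g : 𝓢(E n, ℂ)) : inner ℂ (res Ω f) (res Ω g) = inner ℂ (toL2 f) (toL2 g) := by
  rw [L2.inner_def, L2.inner_def]
  have h1 : ∫ x, inner ℂ (toL2 f x) (toL2 g x) = ∫ x, inner ℂ (f x) (g x) := by
    refine integral_congr_ae ?_
    filter_upwards [coeFn_toL2 f, coeFn_toL2 g] with x hx hy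
    rw [hx, hy]
  have h2 : ∫ x in (Ω : Set (E n)), inner ℂ (res Ω f x) (res Ω g x) =
      ∫ x in (Ω : Set (E n)), inner ℂ (f x) (g x) := by
    refine integral_congr_ae ?_
    filter_upwards [coeFn_res Ω f, coeFn_res Ω g] with x hx hy
    rw [hx, hy]
  rw [h1, h2]
  refine setIntegral_eq_integral_of_forall_compl_eq_zero fun x hx => ?_
  rw [image_eq_zero_of_notMem_tsupport fun h => hx (hf h), inner_zero_left]

/-- Schwartz functions with compact support in `Ω`. -/
def testSpace (Ω : TopologicalSpace.Opens (E n)) : Submodule ℂ 𝓢(E n, ℂ) where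
  carrier := {f | HasCompactSupport f ∧ tsupport f ⊆ Ω}
  add_mem' := fun {f g} hf hg => ⟨hf.1.add hg.1,
    (tsupport_add f g).trans (Set.union_subset hf.2 hg.2)⟩
  zero_mem' := by
    have h : ⇑(0 : 𝓢(E n, ℂ)) = 0 := rfl
    constructor <;> rw [h]
    · exact HasCompactSupport.zero
    · simp [tsupport]
  smul_mem' := fun a f hf => ⟨hf.1.smul_left (f := fun _ => a),
    (tsupport_smul_subset_right (fun _ => a) f).trans hf.2⟩

theorem mem_testSpace {Ω : TopologicalSpace.Opens (E n)} {f : 𝓢(E n, ℂ)} :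
    f ∈ testSpace Ω ↔ HasCompactSupport f ∧ tsupport f ⊆ Ω := Iff.rfl

/-- The pair `(f, P(D) f)` in `L²(Ω) × L²(Ω)`. -/
def graphMap (P : MvPolynomial (Fin n) ℝ) (Ω : TopologicalSpace.Opens (E n)) :
    𝓢(E n, ℂ) →L[ℂ] L2 Ω × L2 Ω :=
  (res Ω).prod ((res Ω).comp (Op (complexify P)))

/-- The space `H_0^P(Ω)` as a closed subspace. -/
def H0Sub (P : MvPolynomial (Fin n) ℝ) (Ω : TopologicalSpace.Opens (E n)) :
    Submodule ℂ (L2 Ω × L2 Ω) :=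
  ((testSpace Ω).map (graphMap P Ω).toLinearMap).topologicalClosure

/-- A test function as a Schwartz function. -/
def toSchwartz {Ω : TopologicalSpace.Opens (E n)} (φ : 𝓓(Ω, ℂ)) : 𝓢(E n, ℂ) :=
  φ.hasCompactSupport.toSchwartzMap φ.contDiff

theorem toSchwartz_mem {Ω : TopologicalSpace.Opens (E n)} (φ : 𝓓(Ω, ℂ)) :
    toSchwartz φ ∈ testSpace Ω := ⟨φ.hasCompactSupport, φ.tsupport_subset⟩

theorem coe_H0Sub (P : MvPolynomial (Fin n) ℝ) (Ω : TopologicalSpace.Opens (E n)) :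
    (H0Sub P Ω : Set (L2 Ω × L2 Ω)) = H0 P Ω := by
  rw [H0Sub, Submodule.topologicalClosure_coe, H0]
  congr 1
  ext p
  simp only [Submodule.map_coe, Set.mem_image, SetLike.mem_coe, Set.mem_ofPred_eq]
  constructor
  · rintro ⟨f, hf, rfl⟩
    obtain ⟨h1, h2⟩ := mem_testSpace.1 hf
    refine ⟨⟨f, f.smooth _, h1, h2⟩, coeFn_res Ω f, ?_⟩
    exact (coeFn_res Ω _).trans (EventuallyEq.of_eq (opD_eq_Op P f).symm)
  · rintro ⟨φ, h1, h2⟩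
    refine ⟨toSchwartz φ, toSchwartz_mem φ, Prod.ext (Lp.ext ?_) (Lp.ext ?_)⟩
    · exact (coeFn_res Ω _).trans h1.symm
    · exact (coeFn_res Ω _).trans
        ((EventuallyEq.of_eq (opD_eq_Op P (toSchwartz φ)).symm).trans h2.symm)

theorem mem_H0Sub {P : MvPolynomial (Fin n) ℝ} {Ω : TopologicalSpace.Opens (E n)}
    {u : L2 Ω × L2 Ω} : u ∈ H0Sub P Ω ↔ u ∈ H0 P Ω := by
  rw [← coe_H0Sub, SetLike.mem_coe]

theorem isClosed_H0Sub (P : MvPolynomial (Fin n) ℝ) (Ω : TopologicalSpace.Opens (E n)) :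
    IsClosed (H0Sub P Ω : Set (L2 Ω × L2 Ω)) := Submodule.isClosed_topologicalClosure _

theorem graphMap_mem {P : MvPolynomial (Fin n) ℝ} {Ω : TopologicalSpace.Opens (E n)}
    {f : 𝓢(E n, ℂ)} (hf : f ∈ testSpace Ω) : graphMap P Ω f ∈ H0Sub P Ω :=
  Submodule.le_topologicalClosure _ ⟨f, hf, rfl⟩

/-- Density: closed conditions need only be checked on graphs of test functions. -/
theorem H0Sub_induction {P : MvPolynomial (Fin n) ℝ} {Ω : TopologicalSpace.Opens (E n)}
    {p : L2 Ω × L2 Ω → Prop} (hc : IsClosed {u | p u})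
    (h : ∀ f ∈ testSpace Ω, p (res Ω f, res Ω (Op (complexify P) f))) :
    ∀ u ∈ H0Sub P Ω, p u := by
  intro u hu
  refine closure_minimal (t := {u | p u}) ?_ hc hu
  rintro _ ⟨f, hf, rfl⟩
  exact h f hf

theorem Op_mem_testSpace {Ω : TopologicalSpace.Opens (E n)} (Q : MvPolynomial (Fin n) ℂ)
    {f : 𝓢(E n, ℂ)} (hf : f ∈ testSpace Ω) : Op Q f ∈ testSpace Ω :=
  ⟨hf.1.mono' (subset_closure.trans (tsupport_Op_subset Q f)), (tsupport_Op_subset Q f).trans hf.2⟩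

theorem conjPoly_complexify (P : MvPolynomial (Fin n) ℝ) :
    conjPoly (complexify P) = complexify P := by
  ext m; simp [complexify, conjPoly, MvPolynomial.coeff_map, Complex.conj_ofReal]

/-- `P(D)` is symmetric on `H_0^P(Ω)`. -/
theorem inner_symm_of_mem_H0Sub {P : MvPolynomial (Fin n) ℝ} {Ω : TopologicalSpace.Opens (E n)}
    {u v : L2 Ω × L2 Ω} (hu : u ∈ H0Sub P Ω) (hv : v ∈ H0Sub P Ω) :
    inner ℂ u.2 v.1 = inner ℂ u.1 v.2 := by
  refine H0Sub_induction (p := fun v => inner ℂ u.2 v.1 = inner ℂ u.1 v.2)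
    (isClosed_eq (by fun_prop) (by fun_prop)) (fun g hg => ?_) v hv
  refine H0Sub_induction (p := fun u => inner ℂ u.2 (res Ω g) =
    inner ℂ u.1 (res Ω (Op (complexify P) g)))
    (isClosed_eq (by fun_prop) (by fun_prop)) (fun f hf => ?_) u hu
  rw [inner_res (Op_mem_testSpace _ hf).2, inner_res hf.2, inner_Op, conjPoly_complexify]

theorem Op_complexify_sub_C (P : MvPolynomial (Fin n) ℝ) (lam : ℝ) (f : 𝓢(E n, ℂ)) :
    Op (complexify (P - MvPolynomial.C lam)) f = Op (complexify P) f - (lam : ℂ) • f := by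
  have : complexify (P - MvPolynomial.C lam) = complexify P + MvPolynomial.C (-(lam : ℂ)) := by
    simp [complexify, sub_eq_add_neg]
  rw [this, Op_add, Op_C, neg_smul, sub_eq_add_neg]

theorem polySymbol_complexify (P : MvPolynomial (Fin n) ℝ) (ξ : E n) :
    polySymbol (complexify P) ξ = (symbol P ((2 * Real.pi) • ξ) : ℂ) := by
  rw [polySymbol, complexify, symbol, MvPolynomial.eval_map]
  change _ = Complex.ofRealHom _
  rw [MvPolynomial.eval, MvPolynomial.coe_eval₂Hom, MvPolynomial.hom_eval₂]
  simp

/-- A lower bound for `|P(ξ) - λ|` gives a lower bound for `P(D) - λ`. -/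
theorem mul_norm_le_of_le_abs_symbol_sub {P : MvPolynomial (Fin n) ℝ}
    {Ω : TopologicalSpace.Opens (E n)} {lam K : ℝ} (hK : 0 < K)
    (h : ∀ ξ : E n, K ≤ |symbol P ξ - lam|) {u : L2 Ω × L2 Ω} (hu : u ∈ H0Sub P Ω) :
    K * ‖u.1‖ ≤ ‖u.2 - (lam : ℂ) • u.1‖ := by
  refine H0Sub_induction (p := fun u => K * ‖u.1‖ ≤ ‖u.2 - (lam : ℂ) • u.1‖)
    (isClosed_le (by fun_prop) (by fun_prop)) (fun f hf => ?_) u hu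
  rw [← map_smul, ← map_sub, ← Op_complexify_sub_C, norm_res hf.2,
    norm_res (Op_mem_testSpace _ hf).2]
  have h1 := nrm_Op_le (p := 1) (q := complexify (P - MvPolynomial.C lam)) (c := K⁻¹)
    (by positivity) (fun ξ => ?_) f
  · rwa [Op_one, inv_mul_eq_div, le_div_iff₀' hK] at h1
  · rw [inv_mul_eq_div, le_div_iff₀ hK, polySymbol_complexify, Complex.norm_real, Real.norm_eq_abs]
    simpa [polySymbol, symbol] using h ((2 * Real.pi) • ξ)

/-! ### The Carleman estimate on `H_0^P(Ω)` and its consequences. -/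

/-- Multiplication by an essentially bounded function on `L²(Ω)`. -/
def mulL2 (Ω : TopologicalSpace.Opens (E n)) {g : E n → ℂ}
    (hg : MemLp g ∞ (volume.restrict (Ω : Set (E n)))) : L2 Ω →L[ℂ] L2 Ω :=
  (ContinuousLinearMap.mul ℂ ℂ).holderL (volume.restrict (Ω : Set (E n))) ∞ 2 2 hg.toLp

theorem coeFn_mulL2 (Ω : TopologicalSpace.Opens (E n)) {g : E n → ℂ}
    (hg : MemLp g ∞ (volume.restrict (Ω : Set (E n)))) (u : L2 Ω) :
    mulL2 Ω hg u =ᵐ[volume.restrict (Ω : Set (E n))] fun x => g x * u x := by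
  filter_upwards [(ContinuousLinearMap.mul ℂ ℂ).coeFn_holder (r := 2) hg.toLp u, hg.coeFn_toLp]
    with x hx hy
  rw [← hy]
  exact hx

theorem memLp_exp {Ω : TopologicalSpace.Opens (E n)} {R : ℝ}
    (hΩ : (Ω : Set (E n)) ⊆ Metric.closedBall 0 R) (τ : ℝ) (j : Fin n) :
    MemLp (fun x : E n => ((Real.exp (τ * x j) : ℝ) : ℂ)) ∞ (volume.restrict (Ω : Set (E n))) := by
  have hcont : Continuous fun x : E n => ((Real.exp (τ * x j) : ℝ) : ℂ) := by fun_prop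
  refine memLp_top_of_bound hcont.aestronglyMeasurable (Real.exp (|τ| * R)) ?_
  filter_upwards [ae_restrict_mem Ω.isOpen.measurableSet] with x hx
  rw [Complex.norm_real, Real.norm_eq_abs, Real.abs_exp, Real.exp_le_exp]
  have h1 : |x j| ≤ R := (PiLp.norm_apply_le x j).trans (mem_closedBall_zero_iff.1 (hΩ hx))
  calc τ * x j ≤ |τ * x j| := le_abs_self _
    _ = |τ| * |x j| := abs_mul _ _
    _ ≤ |τ| * R := mul_le_mul_of_nonneg_left h1 (abs_nonneg _)

theorem contDiff_exp_coord (τ : ℝ) (j : Fin n) :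
    ContDiff ℝ (⊤ : ℕ∞) fun x : E n => ((Real.exp (τ * x j) : ℝ) : ℂ) :=
  Complex.ofRealCLM.contDiff.comp
    (Real.contDiff_exp.comp (contDiff_const.mul (EuclideanSpace.proj (𝕜 := ℝ) j).contDiff))

theorem exists_exp_mul (Ω : TopologicalSpace.Opens (E n)) (τ : ℝ) (j : Fin n)
    {f : 𝓢(E n, ℂ)} (hf : f ∈ testSpace Ω) :
    ∃ g ∈ testSpace Ω, ∀ x, g x = (Real.exp (τ * x j) : ℂ) * f x := by
  have h1 : HasCompactSupport fun x => (Real.exp (τ * x j) : ℂ) * f x := hf.1.mul_left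
  refine ⟨h1.toSchwartzMap ((contDiff_exp_coord τ j).mul (f.smooth _)), ⟨h1, ?_⟩, fun x => rfl⟩
  exact (tsupport_mul_subset_right (f := fun x : E n => (Real.exp (τ * x j) : ℂ))).trans hf.2

/-- A Carleman estimate with a linear weight on `H_0^P(Ω)`. -/
theorem exists_carleman (P : MvPolynomial (Fin n) ℝ) (hP : 1 ≤ P.totalDegree) (lam : ℝ)
    {Ω : TopologicalSpace.Opens (E n)} {R : ℝ} (hR : 0 ≤ R)
    (hΩ : (Ω : Set (E n)) ⊆ Metric.closedBall 0 R) :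
    ∃ j : Fin n, ∃ c : ℝ, 0 < c ∧ ∀ τ : ℝ, 0 ≤ τ → ∀ u ∈ H0Sub P Ω,
      c * τ * ‖mulL2 Ω (memLp_exp hΩ τ j) u.1‖ ≤
        ‖mulL2 Ω (memLp_exp hΩ τ j) (u.2 - (lam : ℂ) • u.1)‖ := by
  -- If `P - λ` were constant, `P` would be too.
  have hdeg : 1 ≤ (P - MvPolynomial.C lam).totalDegree := by
    by_contra h
    have h0 : (P - MvPolynomial.C lam).totalDegree = 0 := by omega
    rw [MvPolynomial.totalDegree_eq_zero_iff_eq_C] at h0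
    have h1 : P = MvPolynomial.C ((P - MvPolynomial.C lam).coeff 0 + lam) := by
      rw [map_add, ← h0]; ring
    rw [h1, MvPolynomial.totalDegree_C] at hP
    omega
  obtain ⟨j, c, hc, h⟩ := exists_mul_nrm_le_nrm_Op_shift _ hdeg hR
  refine ⟨j, c, hc, fun τ hτ => H0Sub_induction
    (isClosed_le (by fun_prop) (by fun_prop)) fun f hf => ?_⟩
  obtain ⟨g, hg, hgf⟩ := exists_exp_mul Ω τ j hf
  have hres : ∀ f g : 𝓢(E n, ℂ), (∀ x, g x = (Real.exp (τ * x j) : ℂ) * f x) →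
      mulL2 Ω (memLp_exp hΩ τ j) (res Ω f) = res Ω g := by
    intro f g hfg
    refine Lp.ext ((coeFn_mulL2 Ω _ _).trans ?_)
    filter_upwards [coeFn_res Ω f, coeFn_res Ω g] with x hx hy
    rw [hx, hy, hfg]
  rw [← map_smul, ← map_sub, ← Op_complexify_sub_C, hres f g hgf,
    hres _ _ (Op_shift_exp τ j _ f g hgf), norm_res hg.2, norm_res (Op_mem_testSpace _ hg).2]
  exact h τ hτ g (hg.2.trans hΩ)

/-- An element of `H_0^P(Ω)` with `|(P(D) - λ) u| ≤ M |u|` vanishes. -/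
theorem eq_zero_of_norm_sub_le (P : MvPolynomial (Fin n) ℝ) (hP : 1 ≤ P.totalDegree) (lam : ℝ)
    {Ω : TopologicalSpace.Opens (E n)} (hΩ : Bornology.IsBounded (Ω : Set (E n)))
    {M : ℝ} (hM : 0 ≤ M) {u : L2 Ω × L2 Ω} (hu : u ∈ H0Sub P Ω)
    (h : ∀ᵐ x ∂volume.restrict (Ω : Set (E n)), ‖u.2 x - (lam : ℂ) * u.1 x‖ ≤ M * ‖u.1 x‖) :
    u = 0 := by
  obtain ⟨R, hR, hΩR⟩ := hΩ.subset_closedBall_lt 0 0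
  obtain ⟨j, c, hc, hcar⟩ := exists_carleman P hP lam hR.le hΩR
  have hsub : (u.2 - (lam : ℂ) • u.1 : L2 Ω) =ᵐ[volume.restrict (Ω : Set (E n))]
      fun x => u.2 x - (lam : ℂ) * u.1 x := by
    filter_upwards [Lp.coeFn_sub u.2 ((lam : ℂ) • u.1), Lp.coeFn_smul (lam : ℂ) u.1] with x hx hy
    rw [hx, Pi.sub_apply, hy]
    rfl
  -- With `cτ = M + 1` the Carleman factor beats `M`, which forces the weighted function, hence
  -- `u.1`, to vanish.
  set τ := (M + 1) / c with hτ
  have hτ0 : 0 ≤ τ := by positivity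
  have h1 := hcar τ hτ0 u hu
  have h2 : ‖mulL2 Ω (memLp_exp hΩR τ j) (u.2 - (lam : ℂ) • u.1)‖ ≤
      M * ‖mulL2 Ω (memLp_exp hΩR τ j) u.1‖ := by
    refine Lp.norm_le_mul_norm_of_ae_le_mul ?_
    filter_upwards [h, hsub, coeFn_mulL2 Ω (memLp_exp hΩR τ j) (u.2 - (lam : ℂ) • u.1),
      coeFn_mulL2 Ω (memLp_exp hΩR τ j) u.1] with x h3 h4 h5 h6
    rw [h5, h6, h4, norm_mul, norm_mul, mul_left_comm]
    exact mul_le_mul_of_nonneg_left h3 (norm_nonneg _)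
  have h3 : c * τ = M + 1 := by rw [hτ]; field_simp
  rw [h3] at h1
  have h4 : mulL2 Ω (memLp_exp hΩR τ j) u.1 = 0 := by
    rw [← norm_le_zero_iff]
    linarith
  have h5 : u.1 =ᵐ[volume.restrict (Ω : Set (E n))] 0 := by
    have h6 := coeFn_mulL2 Ω (memLp_exp hΩR τ j) u.1
    rw [h4] at h6
    filter_upwards [h6, Lp.coeFn_zero ℂ 2 (volume.restrict (Ω : Set (E n)))] with x hx hy
    rw [hy] at hx
    have h7 := mul_eq_zero.1 hx.symm
    simpa using h7
  refine Prod.ext (Lp.ext (h5.trans (Lp.coeFn_zero _ _ _).symm))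
    (Lp.ext (EventuallyEq.trans ?_ (Lp.coeFn_zero _ _ _).symm))
  filter_upwards [h, h5] with x hx hy
  rw [hy] at hx
  simpa using hx

/-- The inequality `‖u‖ ≤ C ‖P(D) u‖` on `H_0^P(Ω)`. -/
theorem exists_norm_fst_le (P : MvPolynomial (Fin n) ℝ) (hP : 1 ≤ P.totalDegree)
    {Ω : TopologicalSpace.Opens (E n)} (hΩ : Bornology.IsBounded (Ω : Set (E n))) :
    ∃ C : ℝ, 0 < C ∧ ∀ u ∈ H0Sub P Ω, ‖u.1‖ ≤ C * ‖u.2‖ := by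
  obtain ⟨R, hR, hΩR⟩ := hΩ.subset_closedBall_lt 0 0
  obtain ⟨j, c, hc, hcar⟩ := exists_carleman P hP 0 hR.le hΩR
  -- The single weight `τ = 1` suffices, since multiplication by it is bounded with bounded inverse,
  -- the weight `τ = -1`.
  set W := mulL2 Ω (memLp_exp hΩR 1 j)
  set W' := mulL2 Ω (memLp_exp hΩR (-1) j)
  have hW : ∀ u : L2 Ω, W' (W u) = u := by
    intro u
    refine Lp.ext ?_
    filter_upwards [coeFn_mulL2 Ω (memLp_exp hΩR (-1) j) (W u), coeFn_mulL2 Ω (memLp_exp hΩR 1 j) u]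
      with x hx hy
    rw [hx, hy, ← mul_assoc, ← Complex.ofReal_mul, ← Real.exp_add]
    simp
  refine ⟨‖W'‖ * (‖W‖ / c) + 1, by positivity, fun u hu => ?_⟩
  have h1 := hcar 1 zero_le_one u hu
  rw [Complex.ofReal_zero, zero_smul, sub_zero, mul_one] at h1
  have h2 : ‖W u.1‖ ≤ ‖W‖ / c * ‖u.2‖ := by
    rw [div_mul_eq_mul_div, le_div_iff₀' hc]
    exact h1.trans (W.le_opNorm u.2)
  calc ‖u.1‖ = ‖W' (W u.1)‖ := by rw [hW]
    _ ≤ ‖W'‖ * ‖W u.1‖ := W'.le_opNorm _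
    _ ≤ ‖W'‖ * (‖W‖ / c * ‖u.2‖) := mul_le_mul_of_nonneg_left h2 (norm_nonneg _)
    _ ≤ (‖W'‖ * (‖W‖ / c) + 1) * ‖u.2‖ := by
      have := norm_nonneg u.2
      linarith

/-! ### Compactness of the embedding in `L²(Ω)`. -/

theorem symbolTilde_sq (P : MvPolynomial (Fin n) ℝ) (ξ : E n) :
    symbolTilde P ξ ^ 2 = ∑ α : Fin n → Fin (P.totalDegree + 1),
      symbol (derivPoly P (fun j => (α j : ℕ))) ξ ^ 2 :=
  Real.sq_sqrt (Finset.sum_nonneg fun _ _ => sq_nonneg _)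

theorem exists_radius {P : MvPolynomial (Fin n) ℝ}
    (hPtilde : Tendsto (symbolTilde P) (cocompact (E n)) atTop) (N : ℝ) :
    ∃ r : ℝ, ∀ ξ : E n, ξ ∉ Metric.closedBall 0 r → N ≤ symbolTilde P ((2 * Real.pi) • ξ) := by
  have h := hPtilde.eventually_ge_atTop N
  obtain ⟨K, hK, hKN⟩ := mem_cocompact.1 h
  obtain ⟨r, hr, hKr⟩ := hK.isBounded.subset_closedBall_lt 0 0
  refine ⟨r, fun ξ hξ => hKN fun hmem => hξ ?_⟩
  have h1 := mem_closedBall_zero_iff.1 (hKr hmem)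
  rw [norm_smul, Real.norm_of_nonneg (by positivity)] at h1
  rw [mem_closedBall_zero_iff]
  have h2 := Real.pi_gt_three
  nlinarith [norm_nonneg ξ]

/-- The Fourier transforms of functions `f` supported in `Ω` with bounded `‖P(D) f‖` have uniformly
small tails. -/
theorem exists_nrm_sq_le_setIntegral_add {P : MvPolynomial (Fin n) ℝ}
    (hPtilde : Tendsto (symbolTilde P) (cocompact (E n)) atTop) {R : ℝ} (hR : 0 ≤ R) {ε : ℝ}
    (hε : 0 < ε) : ∃ r : ℝ, ∀ f : 𝓢(E n, ℂ), tsupport f ⊆ Metric.closedBall 0 R →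
      nrm f ^ 2 ≤ (∫ ξ in Metric.closedBall 0 r, ‖𝓕 f ξ‖ ^ 2) +
        ε * nrm (Op (complexify P) f) ^ 2 := by
  choose C hC h using fun α : Fin n → Fin (P.totalDegree + 1) =>
    exists_nrm_Op_derivPoly_le P hR fun j => (α j : ℕ)
  set A := ∑ α, C α ^ 2
  have hA : 0 ≤ A := Finset.sum_nonneg fun _ _ => sq_nonneg _
  -- Outside this radius `1 ≤ (ε / (A + 1)) P̃²`, while the derivatives contribute in total at most
  -- `A ‖P(D)f‖²`; `A + 1` avoids dividing by zero.
  obtain ⟨r, hr⟩ := exists_radius hPtilde (Real.sqrt ((A + 1) / ε))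
  refine ⟨r, fun f hf => ?_⟩
  have hint : ∀ g : 𝓢(E n, ℂ), Integrable fun ξ => ‖𝓕 g ξ‖ ^ 2 := fun g =>
    integrable_norm_sq (𝓕 g)
  have hsq : ∀ g : 𝓢(E n, ℂ), ∫ ξ, ‖𝓕 g ξ‖ ^ 2 = nrm g ^ 2 := fun g => by
    rw [← nrm_fourier, nrm_sq]
  have h1 : ∫ ξ in (Metric.closedBall (0 : E n) r)ᶜ, ‖𝓕 f ξ‖ ^ 2 ≤
      ∫ ξ in (Metric.closedBall (0 : E n) r)ᶜ, (ε / (A + 1)) *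
        ∑ α : Fin n → Fin (P.totalDegree + 1), ‖𝓕 (Op (complexify (derivPoly P fun j => (α j : ℕ))) f) ξ‖ ^ 2 := by
    refine setIntegral_mono_on (hint f).integrableOn
      ((integrable_finsetSum _ fun α _ => hint _).const_mul _).integrableOn
      Metric.isClosed_closedBall.measurableSet.compl fun ξ hξ => ?_
    have h2 := hr ξ hξ
    rw [Real.sqrt_le_left (show 0 ≤ symbolTilde P _ from Real.sqrt_nonneg _), symbolTilde_sq,
      div_le_iff₀' hε] at h2
    have h3 : ∑ α : Fin n → Fin (P.totalDegree + 1),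
        ‖𝓕 (Op (complexify (derivPoly P fun j => (α j : ℕ))) f) ξ‖ ^ 2 =
        (∑ α : Fin n → Fin (P.totalDegree + 1),
          symbol (derivPoly P (fun j => (α j : ℕ))) ((2 * Real.pi) • ξ) ^ 2) * ‖𝓕 f ξ‖ ^ 2 := by
      rw [Finset.sum_mul]
      refine Finset.sum_congr rfl fun α _ => ?_
      rw [fourier_Op, polySymbol_complexify, norm_mul, mul_pow, Complex.norm_real,
        Real.norm_eq_abs, sq_abs]
    rw [h3, ← mul_assoc, div_mul_eq_mul_div]
    refine le_mul_of_one_le_left (sq_nonneg _) ?_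
    rwa [one_le_div (by positivity)]
  have h2 : ∫ ξ in (Metric.closedBall (0 : E n) r)ᶜ, (ε / (A + 1)) *
      ∑ α : Fin n → Fin (P.totalDegree + 1),
        ‖𝓕 (Op (complexify (derivPoly P fun j => (α j : ℕ))) f) ξ‖ ^ 2 ≤
      ε * nrm (Op (complexify P) f) ^ 2 := by
    refine (setIntegral_le_integral
      ((integrable_finsetSum _ fun α _ => hint _).const_mul _) (ae_of_all _ fun ξ => ?_)).trans ?_
    · exact mul_nonneg (by positivity) (Finset.sum_nonneg fun _ _ => sq_nonneg _)
    rw [integral_const_mul, integral_finsetSum _ fun α _ => hint _]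
    simp_rw [hsq]
    have h3 : ∑ α : Fin n → Fin (P.totalDegree + 1),
        nrm (Op (complexify (derivPoly P fun j => (α j : ℕ))) f) ^ 2 ≤
        (A + 1) * nrm (Op (complexify P) f) ^ 2 := by
      refine le_trans ?_ (mul_le_mul_of_nonneg_right (le_add_of_nonneg_right zero_le_one)
        (sq_nonneg _))
      rw [Finset.sum_mul]
      refine Finset.sum_le_sum fun α _ => ?_
      rw [← mul_pow]
      exact pow_le_pow_left₀ (nrm_nonneg _) (h α f hf) 2
    calc ε / (A + 1) * _ ≤ ε / (A + 1) * ((A + 1) * nrm (Op (complexify P) f) ^ 2) :=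
          mul_le_mul_of_nonneg_left h3 (by positivity)
      _ = _ := by field_simp
  rw [← hsq f, ← integral_add_compl
    (Metric.isClosed_closedBall (x := (0 : E n)) (ε := r)).measurableSet
    (hint f)]
  linarith

/-- Every bounded sequence in `L²(Ω)` has a weakly convergent subsequence. -/
theorem exists_weak_subseq {Ω : TopologicalSpace.Opens (E n)} (x : ℕ → L2 Ω) {M : ℝ}
    (hM : ∀ k, ‖x k‖ ≤ M) : ∃ φ : ℕ → ℕ, StrictMono φ ∧ ∀ y : L2 Ω, ∃ a : ℂ,
      Tendsto (fun k => inner ℂ (x (φ k)) y) atTop (𝓝 a) := by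
  -- Provides separability of `L²(Ω)`, needed for sequential Banach–Alaoglu.
  have : Fact ((2 : ℝ≥0∞) ≠ ∞) := ⟨by norm_num⟩
  have h := WeakDual.isSeqCompact_closedBall ℂ (L2 Ω) 0 M
  obtain ⟨a, -, φ, hφ, hlim⟩ := h (x := fun k => StrongDual.toWeakDual
    (InnerProductSpace.toDual ℂ (L2 Ω) (x k))) (fun k => by simpa using hM k)
  refine ⟨φ, hφ, fun y => ⟨a y, ?_⟩⟩
  exact ((WeakDual.eval_continuous y).tendsto a).comp hlim

theorem memLp_char (Ω : TopologicalSpace.Opens (E n)) (hΩ : Bornology.IsBounded (Ω : Set (E n)))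
    (ξ : E n) : MemLp (fun x : E n => ((Real.fourierChar (inner ℝ x ξ) : Circle) : ℂ)) 2
      (volume.restrict (Ω : Set (E n))) := by
  have : IsFiniteMeasure (volume.restrict (Ω : Set (E n))) :=
    ⟨by rw [Measure.restrict_apply_univ]; exact hΩ.measure_lt_top⟩
  have hc : Continuous fun x : E n => ((Real.fourierChar (inner ℝ x ξ) : Circle) : ℂ) := by
    fun_prop
  exact MemLp.of_bound hc.aestronglyMeasurable 1 (ae_of_all _ fun x =>
    (Circle.norm_coe _).le)

/-- Because `Ω` is bounded, characters belong to `L²(Ω)`; weak convergence therefore gives pointwise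
convergence of Fourier transforms. -/
theorem fourier_eq_inner {Ω : TopologicalSpace.Opens (E n)}
    (hΩ : Bornology.IsBounded (Ω : Set (E n))) {f : 𝓢(E n, ℂ)} (hf : tsupport f ⊆ Ω) (ξ : E n) :
    𝓕 f ξ = conj (inner ℂ (res Ω f) (memLp_char Ω hΩ ξ).toLp) := by
  rw [inner_conj_symm, L2.inner_def, fourier_coe, Real.fourier_eq]
  rw [← setIntegral_eq_integral_of_forall_compl_eq_zero (s := (Ω : Set (E n)))]
  · refine integral_congr_ae ?_
    filter_upwards [coeFn_res Ω f, (memLp_char Ω hΩ ξ).coeFn_toLp] with x hx hy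
    rw [hx, hy, RCLike.inner_apply, Circle.smul_def, smul_eq_mul, mul_comm,
      Real.fourierChar.map_neg_eq_inv, Circle.coe_inv_eq_conj]
  · intro x hx
    rw [image_eq_zero_of_notMem_tsupport fun h => hx (hf h), smul_zero]

theorem norm_char_toLp_le {Ω : TopologicalSpace.Opens (E n)}
    (hΩ : Bornology.IsBounded (Ω : Set (E n))) :
    ∃ A : ℝ, ∀ ξ : E n, ‖(memLp_char Ω hΩ ξ).toLp‖ ≤ A := by
  refine ⟨‖(memLp_char Ω hΩ 0).toLp‖, fun ξ => Lp.norm_le_norm_of_ae_le ?_⟩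
  filter_upwards [(memLp_char Ω hΩ ξ).coeFn_toLp, (memLp_char Ω hΩ 0).coeFn_toLp] with x hx hy
  rw [hx, hy]
  exact ((Circle.norm_coe _).trans (Circle.norm_coe _).symm).le

/-- Compactness of the embedding of `H_0^P(Ω)` in `L²(Ω)`, on test functions. -/
theorem exists_cauchySeq_res {P : MvPolynomial (Fin n) ℝ}
    (hPtilde : Tendsto (symbolTilde P) (cocompact (E n)) atTop)
    {Ω : TopologicalSpace.Opens (E n)} (hΩ : Bornology.IsBounded (Ω : Set (E n)))
    (f : ℕ → 𝓢(E n, ℂ)) (hf : ∀ k, f k ∈ testSpace Ω) {M : ℝ} (hM1 : ∀ k, ‖res Ω (f k)‖ ≤ M)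
    (hM2 : ∀ k, nrm (Op (complexify P) (f k)) ≤ M) :
    ∃ φ : ℕ → ℕ, StrictMono φ ∧ CauchySeq fun k => res Ω (f (φ k)) := by
  obtain ⟨R, hR, hΩR⟩ := hΩ.subset_closedBall_lt 0 0
  obtain ⟨φ, hφ, hlim⟩ := exists_weak_subseq _ hM1
  obtain ⟨A, hA⟩ := norm_char_toLp_le hΩ
  have hM0 : 0 ≤ M := (nrm_nonneg _).trans (hM2 0)
  refine ⟨φ, hφ, cauchySeq_iff_tendsto_dist_atTop_0.2 ?_⟩
  have hF : ∀ ξ : E n, ∃ a : ℂ, Tendsto (fun k => 𝓕 (f (φ k)) ξ) atTop (𝓝 a) := by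
    intro ξ
    obtain ⟨a, ha⟩ := hlim (memLp_char Ω hΩ ξ).toLp
    refine ⟨conj a, ?_⟩
    simp_rw [fun k => fourier_eq_inner hΩ (hf (φ k)).2 ξ]
    exact (Complex.continuous_conj.tendsto a).comp ha
  have hbound : ∀ k ξ, ‖𝓕 (f k) ξ‖ ≤ M * A := by
    intro k ξ
    rw [fourier_eq_inner hΩ (hf k).2 ξ, RCLike.norm_conj]
    exact (norm_inner_le_norm _ _).trans (mul_le_mul (hM1 k) (hA ξ) (norm_nonneg _) hM0)
  have hsub : ∀ k l, f k - f l ∈ testSpace Ω := fun k l => Submodule.sub_mem _ (hf k) (hf l)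
  have hfsub : ∀ k l ξ, 𝓕 (f k - f l) ξ = 𝓕 (f k) ξ - 𝓕 (f l) ξ := by
    intro k l ξ
    rw [sub_eq_add_neg, fourier_add_apply, ← neg_one_smul ℂ (f l), fourier_smul_apply]
    ring
  -- On a ball, the pointwise limits and the uniform bound `M * A` allow dominated convergence; the
  -- tails are handled by `exists_nrm_sq_le_setIntegral_add`.
  have hball : ∀ r : ℝ, Tendsto (fun p : ℕ × ℕ =>
      ∫ ξ in Metric.closedBall (0 : E n) r, ‖𝓕 (f (φ p.1) - f (φ p.2)) ξ‖ ^ 2) atTop (𝓝 0) := by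
    intro r
    have h0 : (0 : ℝ) = ∫ _ in Metric.closedBall (0 : E n) r, (0 : ℝ) := by simp
    rw [h0]
    refine tendsto_integral_filter_of_dominated_convergence (fun _ => (M * A + M * A) ^ 2)
      (Eventually.of_forall fun p => ?_) (Eventually.of_forall fun p => ?_) ?_ ?_
    · exact ((𝓕 (f (φ p.1) - f (φ p.2))).continuous.norm.pow 2).aestronglyMeasurable
    · refine ae_of_all _ fun ξ => ?_
      rw [hfsub, Real.norm_of_nonneg (sq_nonneg _)]
      exact pow_le_pow_left₀ (norm_nonneg _)
        ((norm_sub_le _ _).trans (add_le_add (hbound _ _) (hbound _ _))) 2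
    · have : IsFiniteMeasure (volume.restrict (Metric.closedBall (0 : E n) r)) :=
        ⟨by rw [Measure.restrict_apply_univ]; exact Metric.isBounded_closedBall.measure_lt_top⟩
      exact integrable_const _
    · refine ae_of_all _ fun ξ => ?_
      obtain ⟨a, ha⟩ := hF ξ
      rw [← prod_atTop_atTop_eq]
      have h1 := ((ha.comp tendsto_fst).sub (ha.comp tendsto_snd) :
        Tendsto _ ((atTop : Filter ℕ) ×ˢ (atTop : Filter ℕ)) _)
      have h2 := (h1.norm.pow 2)
      simp only [sub_self, norm_zero, ne_eq, OfNat.ofNat_ne_zero, not_false_eq_true, zero_pow,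
        Function.comp_apply] at h2
      simpa only [hfsub] using h2
  have hdist : ∀ p : ℕ × ℕ, dist (res Ω (f (φ p.1))) (res Ω (f (φ p.2))) =
      nrm (f (φ p.1) - f (φ p.2)) := by
    intro p
    rw [dist_eq_norm, ← map_sub, norm_res (hsub _ _).2]
  simp_rw [hdist]
  rw [Metric.tendsto_nhds]
  intro ε hε
  obtain ⟨r, hr⟩ := exists_nrm_sq_le_setIntegral_add hPtilde hR.le
    (ε := ε ^ 2 / (2 * (M + M + 1) ^ 2)) (by positivity)
  have h1 := (hball r).eventually_lt_const (show (0 : ℝ) < ε ^ 2 / 2 by positivity)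
  filter_upwards [h1] with p hp
  rw [Real.dist_eq, sub_zero, abs_of_nonneg (nrm_nonneg _)]
  refine lt_of_pow_lt_pow_left₀ 2 hε.le ?_
  refine (hr _ ((hsub _ _).2.trans hΩR)).trans_lt ?_
  have h2 : nrm (Op (complexify P) (f (φ p.1) - f (φ p.2))) ≤ M + M + 1 := by
    rw [map_sub]
    exact (nrm_sub_le _ _).trans ((add_le_add (hM2 _) (hM2 _)).trans (by linarith))
  have h3 : ε ^ 2 / (2 * (M + M + 1) ^ 2) *
      nrm (Op (complexify P) (f (φ p.1) - f (φ p.2))) ^ 2 ≤ ε ^ 2 / 2 := by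
    calc _ ≤ ε ^ 2 / (2 * (M + M + 1) ^ 2) * (M + M + 1) ^ 2 :=
          mul_le_mul_of_nonneg_left (pow_le_pow_left₀ (nrm_nonneg _) h2 2) (by positivity)
      _ = ε ^ 2 / 2 := by field_simp
  linarith

/-- Compactness of the embedding of `H_0^P(Ω)` in `L²(Ω)`. -/
theorem exists_cauchySeq_fst {P : MvPolynomial (Fin n) ℝ} (hP : 1 ≤ P.totalDegree)
    (hPtilde : Tendsto (symbolTilde P) (cocompact (E n)) atTop)
    {Ω : TopologicalSpace.Opens (E n)} (hΩ : Bornology.IsBounded (Ω : Set (E n)))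
    (u : ℕ → L2 Ω × L2 Ω) (hu : ∀ k, u k ∈ H0Sub P Ω) {M : ℝ} (hM : ∀ k, ‖(u k).2‖ ≤ M) :
    ∃ φ : ℕ → ℕ, StrictMono φ ∧ CauchySeq fun k => (u (φ k)).1 := by
  obtain ⟨C, hC, hCu⟩ := exists_norm_fst_le P hP hΩ
  have hM0 : 0 ≤ M := (norm_nonneg _).trans (hM 0)
  -- Replacing each `u k` by a test function with error tending to zero does not affect the Cauchy
  -- property.
  have happrox : ∀ k, ∃ f ∈ testSpace Ω, ‖u k - graphMap P Ω f‖ < 1 / ((k : ℝ) + 1) := by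
    intro k
    obtain ⟨_, ⟨f, hf, rfl⟩, h⟩ := Metric.mem_closure_iff.1 (hu k) (1 / ((k : ℝ) + 1))
      (by positivity)
    exact ⟨f, hf, by rwa [dist_eq_norm] at h⟩
  choose f hf hfu using happrox
  have h1 : ∀ k, ‖(u k).1 - res Ω (f k)‖ < 1 / ((k : ℝ) + 1) := fun k =>
    lt_of_le_of_lt (norm_fst_le (u k - graphMap P Ω (f k))) (hfu k)
  have h2 : ∀ k, ‖(u k).2 - res Ω (Op (complexify P) (f k))‖ < 1 / ((k : ℝ) + 1) := fun k =>
    lt_of_le_of_lt (norm_snd_le (u k - graphMap P Ω (f k))) (hfu k)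
  have hk1 : ∀ k : ℕ, 1 / ((k : ℝ) + 1) ≤ 1 := fun k => by
    rw [div_le_one (by positivity)]
    linarith [(Nat.cast_nonneg k : (0 : ℝ) ≤ k)]
  have h3 : ∀ k, nrm (Op (complexify P) (f k)) ≤ M + 1 := by
    intro k
    rw [← norm_res (Op_mem_testSpace _ (hf k)).2]
    have := norm_sub_norm_le (res Ω (Op (complexify P) (f k))) (u k).2
    rw [norm_sub_rev] at this
    linarith [h2 k, hk1 k, hM k]
  have h4 : ∀ k, ‖res Ω (f k)‖ ≤ C * (M + 1) := fun k =>
    (hCu _ (graphMap_mem (hf k))).trans (mul_le_mul_of_nonneg_left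
      ((norm_res (Op_mem_testSpace _ (hf k)).2).trans_le (h3 k)) hC.le)
  obtain ⟨φ, hφ, hcauchy⟩ := exists_cauchySeq_res hPtilde hΩ f hf
    (M := max (C * (M + 1)) (M + 1)) (fun k => (h4 k).trans (le_max_left _ _))
    (fun k => (h3 k).trans (le_max_right _ _))
  refine ⟨φ, hφ, ?_⟩
  have h5 : Tendsto (fun k => (u (φ k)).1 - res Ω (f (φ k))) atTop (𝓝 0) :=
    squeeze_zero_norm (fun k => (h1 (φ k)).le)
      ((tendsto_one_div_add_atTop_nhds_zero_nat (𝕜 := ℝ)).comp hφ.tendsto_atTop)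
  have h6 := h5.cauchySeq.add hcauchy
  have h7 : ((fun k => (u (φ k)).1 - res Ω (f (φ k))) + fun k => res Ω (f (φ k))) =
      fun k => (u (φ k)).1 := funext fun k => sub_add_cancel _ _
  rwa [h7] at h6

/-! ### The Hermitian forms in an abstract Hilbert space. -/

section Form

variable {H : Type*} [NormedAddCommGroup H] [InnerProductSpace ℂ H]

/-- The form `⟨(P - λ) v, T (P - λ) u⟩ + ⟨v, (P - λ) u⟩` on pairs `u = (u, Pu)`, `v = (v, Pv)`. -/
def form (T : H →L[ℂ] H) (lam : ℝ) (u v : H × H) : ℂ :=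
  inner ℂ (v.2 - (lam : ℂ) • v.1) (T (u.2 - (lam : ℂ) • u.1)) +
    inner ℂ v.1 (u.2 - (lam : ℂ) • u.1)

/-- The quadratic form of `form`. -/
def qform (T : H →L[ℂ] H) (lam : ℝ) (u : H × H) : ℝ := (form T lam u u).re

variable (T : H →L[ℂ] H) (lam : ℝ)

theorem continuous_qform : Continuous (qform T lam) := by
  unfold qform form
  fun_prop

theorem form_add_left (u u' v : H × H) :
    form T lam (u + u') v = form T lam u v + form T lam u' v := by
  have h : (u + u').2 - (lam : ℂ) • (u + u').1 =
      (u.2 - (lam : ℂ) • u.1) + (u'.2 - (lam : ℂ) • u'.1) := by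
    rw [Prod.fst_add, Prod.snd_add, smul_add]; abel
  simp only [form, h, map_add, inner_add_right]
  ring

theorem form_add_right (u v v' : H × H) :
    form T lam u (v + v') = form T lam u v + form T lam u v' := by
  have h : (v + v').2 - (lam : ℂ) • (v + v').1 =
      (v.2 - (lam : ℂ) • v.1) + (v'.2 - (lam : ℂ) • v'.1) := by
    rw [Prod.fst_add, Prod.snd_add, smul_add]; abel
  rw [form, h, Prod.fst_add, inner_add_left, inner_add_left, form, form]
  ring

theorem form_smul_left (a : ℂ) (u v : H × H) : form T lam (a • u) v = a * form T lam u v := by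
  have h : (a • u).2 - (lam : ℂ) • (a • u).1 = a • (u.2 - (lam : ℂ) • u.1) := by
    rw [Prod.smul_fst, Prod.smul_snd, smul_sub, smul_comm]
  simp only [form, h, map_smul, inner_smul_right]
  ring

theorem form_smul_right (a : ℂ) (u v : H × H) :
    form T lam u (a • v) = conj a * form T lam u v := by
  have h : (a • v).2 - (lam : ℂ) • (a • v).1 = a • (v.2 - (lam : ℂ) • v.1) := by
    rw [Prod.smul_fst, Prod.smul_snd, smul_sub, smul_comm]
  rw [form, h, Prod.smul_fst, inner_smul_left, inner_smul_left, form]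
  ring

theorem form_conj_symm (hT : ∀ x y : H, inner ℂ x (T y) = inner ℂ (T x) y) {u v : H × H}
    (huv : inner ℂ u.2 v.1 = inner ℂ u.1 v.2) : form T lam v u = conj (form T lam u v) := by
  have h : inner ℂ u.1 (v.2 - (lam : ℂ) • v.1) = inner ℂ (u.2 - (lam : ℂ) • u.1) v.1 := by
    rw [inner_sub_right, inner_sub_left, inner_smul_left, inner_smul_right, huv,
      Complex.conj_ofReal]
  rw [form, form, map_add, inner_conj_symm, inner_conj_symm, hT, h]

theorem qform_real_smul (a : ℝ) (u : H × H) :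
    qform T lam ((a : ℂ) • u) = a ^ 2 * qform T lam u := by
  rw [qform, form_smul_left, form_smul_right, Complex.conj_ofReal, ← mul_assoc,
    ← Complex.ofReal_mul, Complex.re_ofReal_mul, qform, sq]

theorem qform_parallelogram (u v : H × H) :
    qform T lam (u + v) + qform T lam (u - v) = 2 * qform T lam u + 2 * qform T lam v := by
  have h : u - v = u + (-1 : ℂ) • v := by rw [neg_one_smul, sub_eq_add_neg]
  simp only [qform, h, form_add_left, form_add_right, form_smul_left, form_smul_right]
  simp
  ring

/-- For fixed `u` the quadratic form is a quadratic polynomial in `λ` with coefficients controlled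
by `C` and `‖T‖`, hence Lipschitz on bounded intervals, uniformly in `u`. -/
theorem qform_sub_qform_le {C : ℝ} {u : H × H} (hC : 0 ≤ C) (hu : ‖u.1‖ ≤ C)
    (hu' : ‖u.2‖ ≤ 1) {L : ℝ} {lam lam' : ℝ} (h : |lam| ≤ L) (h' : |lam'| ≤ L) :
    |qform T lam u - qform T lam' u| ≤
      (2 * ‖T‖ * C + C ^ 2 + 2 * L * (‖T‖ * C ^ 2)) * |lam - lam'| := by
  set q1 : ℝ := (inner ℂ u.1 (T u.2)).re + (inner ℂ u.2 (T u.1)).re + (inner ℂ u.1 u.1).re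
  set q2 : ℝ := (inner ℂ u.1 (T u.1)).re
  have hq : ∀ l : ℝ, qform T l u =
      (inner ℂ u.2 (T u.2)).re + (inner ℂ u.1 u.2).re - l * q1 + l ^ 2 * q2 := by
    intro l
    simp only [qform, form, map_sub, map_smul, inner_sub_left, inner_sub_right, inner_smul_left,
      inner_smul_right, Complex.conj_ofReal, Complex.add_re, Complex.sub_re, Complex.re_ofReal_mul,
      q1, q2]
    ring
  have hT0 := norm_nonneg T
  have hin : ∀ x y : H, |(inner ℂ x y).re| ≤ ‖x‖ * ‖y‖ := fun x y =>
    (Complex.abs_re_le_norm _).trans (norm_inner_le_norm _ _)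
  have h1 : |(inner ℂ u.1 (T u.2)).re| ≤ C * (‖T‖ * 1) := (hin _ _).trans
    (mul_le_mul hu ((T.le_opNorm _).trans (mul_le_mul_of_nonneg_left hu' hT0)) (norm_nonneg _) hC)
  have h2 : |(inner ℂ u.2 (T u.1)).re| ≤ 1 * (‖T‖ * C) := (hin _ _).trans
    (mul_le_mul hu' ((T.le_opNorm _).trans (mul_le_mul_of_nonneg_left hu hT0)) (norm_nonneg _)
      zero_le_one)
  have h3 : |(inner ℂ u.1 u.1).re| ≤ C * C := (hin _ _).trans
    (mul_le_mul hu hu (norm_nonneg _) hC)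
  have h4 : |q2| ≤ C * (‖T‖ * C) := (hin _ _).trans
    (mul_le_mul hu ((T.le_opNorm _).trans (mul_le_mul_of_nonneg_left hu hT0)) (norm_nonneg _) hC)
  have h5 : |q1| ≤ 2 * ‖T‖ * C + C ^ 2 := by
    refine (abs_add_le _ _).trans ((add_le_add (abs_add_le _ _) le_rfl).trans ?_)
    linarith
  have h6 : |lam + lam'| ≤ 2 * L := (abs_add_le _ _).trans (by linarith)
  have h7 : qform T lam u - qform T lam' u = (lam - lam') * (-q1 + (lam + lam') * q2) := by
    rw [hq, hq]; ring
  rw [h7, abs_mul, mul_comm]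
  refine mul_le_mul_of_nonneg_right ((abs_add_le _ _).trans (add_le_add ?_ ?_)) (abs_nonneg _)
  · rwa [abs_neg]
  · rw [abs_mul]
    refine mul_le_mul h6 (h4.trans_eq (by ring)) (abs_nonneg _) ((abs_nonneg _).trans h6)

/-- A Gårding inequality for `form`. -/
theorem mul_norm_sq_le_qform_add {κ : ℝ} (hκ : 0 < κ)
    (hT : ∀ x : H, κ * ‖x‖ ^ 2 ≤ (inner ℂ x (T x)).re) (u : H × H) :
    κ / 4 * ‖u.2‖ ^ 2 ≤ qform T lam u + (κ * lam ^ 2 / 2 + 1 / (2 * κ)) * ‖u.1‖ ^ 2 := by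
  set w := u.2 - (lam : ℂ) • u.1 with hw
  have h1 : κ * ‖w‖ ^ 2 - ‖u.1‖ * ‖w‖ ≤ qform T lam u := by
    have h2 := (abs_le.1 ((Complex.abs_re_le_norm _).trans (norm_inner_le_norm (𝕜 := ℂ) u.1 w))).1
    have h3 := hT w
    rw [qform, form, Complex.add_re, ← hw]
    linarith
  have h2 : ‖u.2‖ ≤ ‖w‖ + |lam| * ‖u.1‖ := by
    have h3 : u.2 = w + (lam : ℂ) • u.1 := by rw [hw]; abel
    calc ‖u.2‖ = ‖w + (lam : ℂ) • u.1‖ := by rw [← h3]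
      _ ≤ ‖w‖ + ‖(lam : ℂ) • u.1‖ := norm_add_le _ _
      _ = _ := by rw [norm_smul, Complex.norm_real, Real.norm_eq_abs]
  have h3 : ‖u.2‖ ^ 2 ≤ 2 * ‖w‖ ^ 2 + 2 * lam ^ 2 * ‖u.1‖ ^ 2 := by
    have h4 := pow_le_pow_left₀ (norm_nonneg _) h2 2
    have h5 : (|lam| * ‖u.1‖) ^ 2 = lam ^ 2 * ‖u.1‖ ^ 2 := by rw [mul_pow, sq_abs]
    nlinarith [sq_nonneg (‖w‖ - |lam| * ‖u.1‖)]
  have h4 : ‖u.1‖ * ‖w‖ ≤ κ / 2 * ‖w‖ ^ 2 + 1 / (2 * κ) * ‖u.1‖ ^ 2 := by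
    have h5 : κ / 2 * ‖w‖ ^ 2 + 1 / (2 * κ) * ‖u.1‖ ^ 2 - ‖u.1‖ * ‖w‖ =
        (κ * ‖w‖ - ‖u.1‖) ^ 2 / (2 * κ) := by field_simp; ring
    have h6 : 0 ≤ (κ * ‖w‖ - ‖u.1‖) ^ 2 / (2 * κ) := by positivity
    linarith
  have h5 := mul_le_mul_of_nonneg_left h3 (show 0 ≤ κ / 4 by positivity)
  linarith

/-- A null vector of a nonnegative form lies in its kernel. -/
theorem form_eq_zero_of_qform_eq_zero {S : Submodule ℂ (H × H)}
    (hT : ∀ x y : H, inner ℂ x (T y) = inner ℂ (T x) y)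
    (hS : ∀ u ∈ S, ∀ v ∈ S, inner ℂ u.2 v.1 = inner ℂ u.1 v.2)
    (hq : ∀ u ∈ S, 0 ≤ qform T lam u) {u : H × H} (hu : u ∈ S) (hu0 : qform T lam u = 0) :
    ∀ v ∈ S, form T lam u v = 0 := by
  have hre : ∀ v ∈ S, (form T lam u v).re = 0 := by
    intro v hv
    set r := (form T lam u v).re with hr
    have h1 : ∀ t : ℝ, 0 ≤ 2 * t * r + t ^ 2 * qform T lam v := by
      intro t
      have h2 := hq (u + (t : ℂ) • v) (S.add_mem hu (S.smul_mem _ hv))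
      have h3 : qform T lam (u + (t : ℂ) • v) = 2 * t * r + t ^ 2 * qform T lam v := by
        have h4 : (form T lam v u).re = r := by
          rw [form_conj_symm T lam hT (hS u hu v hv), Complex.conj_re]
        have h5 := qform_real_smul T lam t v
        rw [qform] at h5 hu0
        rw [qform, form_add_left, form_add_right, form_add_right, Complex.add_re, Complex.add_re,
          Complex.add_re, h5, hu0, form_smul_left, form_smul_right, Complex.conj_ofReal,
          Complex.re_ofReal_mul, Complex.re_ofReal_mul, h4, ← hr]
        ring
      rwa [h3] at h2
    have hg := hq v hv
    set g := qform T lam v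
    -- Near the minimiser `-r / g`, with `g + 1` to cover `g = 0`; the value is negative unless `r =
    -- 0`.
    have h2 := h1 (-r / (g + 1))
    have h3 : 2 * (-r / (g + 1)) * r + (-r / (g + 1)) ^ 2 * g =
        -(r ^ 2 * (g + 2)) / (g + 1) ^ 2 := by
      field_simp; ring
    rw [h3, neg_div, Left.nonneg_neg_iff] at h2
    by_contra hne
    have : 0 < r ^ 2 * (g + 2) / (g + 1) ^ 2 := by positivity
    linarith
  intro v hv
  refine Complex.ext (hre v hv) ?_
  -- Testing with `i v` turns the imaginary part into a real part.
  have h := hre _ (S.smul_mem Complex.I hv)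
  rw [form_smul_right] at h
  simpa using h

/-- If a form `form T λ₀` is coercive and `form T λ₁` is not positive then `form T λ` has a kernel
for some `λ ≠ λ₀` between them. -/
theorem exists_kernel [CompleteSpace H] {S : Submodule ℂ (H × H)} (hSc : IsClosed (S : Set (H × H)))
    (hT : ∀ x y : H, inner ℂ x (T y) = inner ℂ (T x) y) {κ : ℝ} (hκ : 0 < κ)
    (hTκ : ∀ x : H, κ * ‖x‖ ^ 2 ≤ (inner ℂ x (T x)).re)
    (hS : ∀ u ∈ S, ∀ v ∈ S, inner ℂ u.2 v.1 = inner ℂ u.1 v.2)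
    {C : ℝ} (hC : 0 < C) (hSC : ∀ u ∈ S, ‖u.1‖ ≤ C * ‖u.2‖)
    (hcpt : ∀ u : ℕ → H × H, (∀ k, u k ∈ S) → (∀ k, ‖(u k).2‖ ≤ 1) →
      ∃ φ : ℕ → ℕ, StrictMono φ ∧ CauchySeq fun k => (u (φ k)).1)
    {lam₀ lam₁ c : ℝ} (hc : 0 < c) (hcoer : ∀ u ∈ S, c * ‖u.2‖ ^ 2 ≤ qform T lam₀ u)
    {u₁ : H × H} (hu₁ : u₁ ∈ S) (hu₁0 : u₁ ≠ 0) (hq₁ : qform T lam₁ u₁ ≤ 0) :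
    ∃ s ∈ Set.Ioc (0 : ℝ) 1, ∃ u ∈ S, u ≠ 0 ∧
      ∀ v ∈ S, form T (lam₀ + s * (lam₁ - lam₀)) u v = 0 := by
  set ell : ℝ → ℝ := fun s => lam₀ + s * (lam₁ - lam₀) with hell
  set L := |lam₀| + |lam₁ - lam₀| with hL
  have hellL : ∀ s ∈ Set.Icc (0 : ℝ) 1, |ell s| ≤ L := by
    intro s hs
    refine (abs_add_le _ _).trans (add_le_add le_rfl ?_)
    rw [abs_mul, abs_of_nonneg hs.1]
    exact mul_le_of_le_one_left (abs_nonneg _) hs.2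
  obtain ⟨A, hA, hlip⟩ : ∃ A : ℝ, 0 ≤ A ∧ ∀ s ∈ Set.Icc (0 : ℝ) 1, ∀ s' ∈ Set.Icc (0 : ℝ) 1,
      ∀ u ∈ S, ‖u.2‖ = 1 → |qform T (ell s) u - qform T (ell s') u| ≤ A * |s - s'| := by
    refine ⟨(2 * ‖T‖ * C + C ^ 2 + 2 * L * (‖T‖ * C ^ 2)) * |lam₁ - lam₀|, by positivity,
      fun s hs s' hs' u hu hu1 => ?_⟩
    refine (qform_sub_qform_le T hC.le (by simpa [hu1] using hSC u hu) hu1.le (hellL s hs)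
      (hellL s' hs')).trans_eq ?_
    have : ell s - ell s' = (lam₁ - lam₀) * (s - s') := by simp only [hell]; ring
    rw [this, abs_mul]
    ring
  -- normalisation
  have hnz : ∀ u ∈ S, u ≠ 0 → 0 < ‖u.2‖ := by
    intro u hu hu0
    refine lt_of_le_of_ne (norm_nonneg _) fun h => hu0 ?_
    have h1 := hSC u hu
    rw [← h, mul_zero] at h1
    exact Prod.ext (norm_le_zero_iff.1 h1) (norm_eq_zero.1 h.symm)
  have hnormalize : ∀ u ∈ S, u ≠ 0 → ∃ v ∈ S, ‖v.2‖ = 1 ∧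
      ∀ l, qform T l v = (‖u.2‖⁻¹) ^ 2 * qform T l u := by
    intro u hu hu0
    have h1 := hnz u hu hu0
    refine ⟨((‖u.2‖⁻¹ : ℝ) : ℂ) • u, S.smul_mem _ hu, ?_, fun l => qform_real_smul T l _ u⟩
    rw [Prod.smul_snd, norm_smul, Complex.norm_real, norm_inv, norm_norm]
    exact inv_mul_cancel₀ h1.ne'
  set X : Set ℝ := {s | s ∈ Set.Icc (0 : ℝ) 1 ∧ ∃ u ∈ S, ‖u.2‖ = 1 ∧ qform T (ell s) u ≤ 0} with hX
  have hell0 : ell 0 = lam₀ := by simp [hell]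
  have hell1 : ell 1 = lam₁ := by simp [hell]
  have hXne : X.Nonempty := by
    obtain ⟨v, hv, hv1, hvq⟩ := hnormalize u₁ hu₁ hu₁0
    refine ⟨1, ⟨zero_le_one, le_rfl⟩, v, hv, hv1, ?_⟩
    rw [hell1, hvq]
    exact mul_nonpos_of_nonneg_of_nonpos (sq_nonneg _) hq₁
  have hXbdd : BddBelow X := ⟨0, fun s hs => hs.1.1⟩
  set σ := sInf X with hσ
  have hσ0 : 0 ≤ σ := le_csInf hXne fun s hs => hs.1.1
  have hσ1 : σ ≤ 1 := by
    obtain ⟨s, hs⟩ := hXne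
    exact (csInf_le hXbdd hs).trans hs.1.2
  have hσmem : σ ∈ Set.Icc (0 : ℝ) 1 := ⟨hσ0, hσ1⟩
  have hunit : ∀ u ∈ S, ‖u.2‖ = 1 → 0 ≤ qform T (ell σ) u := by
    intro u hu hu1
    by_contra! hneg
    rcases hσ0.eq_or_lt with h0 | hpos
    · rw [← h0, hell0] at hneg
      have := hcoer u hu
      rw [hu1] at this
      linarith
    -- Moving back by `e` raises the form by at most `A e`, so it stays negative at `σ - e`,
    -- contradicting the infimum.
    · set e := min σ (-qform T (ell σ) u / (A + 1)) with he
      have he0 : 0 < e := lt_min hpos (div_pos (by linarith) (by linarith))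
      have hmem : σ - e ∈ Set.Icc (0 : ℝ) 1 :=
        ⟨sub_nonneg.2 (min_le_left _ _), by linarith⟩
      have h1 := hlip (σ - e) hmem σ hσmem u hu hu1
      have h2 : |σ - e - σ| = e := by rw [sub_sub_cancel_left, abs_neg, abs_of_pos he0]
      rw [h2] at h1
      have h3 : e * (A + 1) ≤ -qform T (ell σ) u :=
        (le_div_iff₀ (by linarith)).1 (min_le_right _ _)
      have h4 := (abs_le.1 h1).2
      have h5 : σ - e ∈ X := ⟨hmem, u, hu, hu1, by linarith⟩
      have := csInf_le hXbdd h5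
      linarith
  have hnonneg : ∀ u ∈ S, 0 ≤ qform T (ell σ) u := by
    intro u hu
    by_cases hu0 : u = 0
    · rw [hu0]; simp [qform, form]
    · obtain ⟨v, hv, hv1, hvq⟩ := hnormalize u hu hu0
      have h1 := hunit v hv hv1
      rw [hvq] at h1
      have := hnz u hu hu0
      exact nonneg_of_mul_nonneg_right h1 (by positivity)
  -- a minimising sequence
  obtain ⟨s, -, hslim, hsX⟩ := exists_seq_tendsto_sInf hXne hXbdd
  choose hsIcc w hwS hw1 hwq using hsX
  obtain ⟨φ, hφ, hcau⟩ := hcpt w hwS fun k => (hw1 k).le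
  have hqlim : Tendsto (fun k => qform T (ell σ) (w (φ k))) atTop (𝓝 0) := by
    have h1 : Tendsto (fun k => A * |σ - s (φ k)|) atTop (𝓝 0) := by
      have h2 := ((tendsto_const_nhds (x := σ)).sub (hslim.comp hφ.tendsto_atTop)).abs.const_mul A
      simpa [hσ] using h2
    refine squeeze_zero (fun k => hunit _ (hwS _) (hw1 _)) (fun k => ?_) h1
    have h2 := (abs_le.1 (hlip σ hσmem _ (hsIcc (φ k)) _ (hwS (φ k)) (hw1 (φ k)))).2
    linarith [hwq (φ k)]
  -- Nonnegativity at `w_k + w_l` and the parallelogram law give `q(w_k - w_l) ≤ 2q(w_k) + 2q(w_l) →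
  -- 0`; Gårding then controls the second components by the first, already Cauchy by compactness.
  have hcau2 : CauchySeq fun k => (w (φ k)).2 := by
    rw [cauchySeq_iff_tendsto_dist_atTop_0]
    have hd1 := cauchySeq_iff_tendsto_dist_atTop_0.1 hcau
    obtain ⟨K, hK⟩ : ∃ K, K = κ * ell σ ^ 2 / 2 + 1 / (2 * κ) := ⟨_, rfl⟩
    have hq2 : Tendsto (fun p : ℕ × ℕ => (κ / 4)⁻¹ * (2 * qform T (ell σ) (w (φ p.1)) +
        2 * qform T (ell σ) (w (φ p.2)) + K * dist (w (φ p.1)).1 (w (φ p.2)).1 ^ 2)) atTop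
        (𝓝 0) := by
      have h1 : Tendsto (fun p : ℕ × ℕ => qform T (ell σ) (w (φ p.1))) atTop (𝓝 0) := by
        rw [← prod_atTop_atTop_eq]; exact hqlim.comp tendsto_fst
      have h2 : Tendsto (fun p : ℕ × ℕ => qform T (ell σ) (w (φ p.2))) atTop (𝓝 0) := by
        rw [← prod_atTop_atTop_eq]; exact hqlim.comp tendsto_snd
      have h3 := (((h1.const_mul 2).add (h2.const_mul 2)).add ((hd1.pow 2).const_mul K)).const_mul
        ((κ / 4)⁻¹)
      simpa using h3
    have hsq : Tendsto (fun p : ℕ × ℕ => dist (w (φ p.1)).2 (w (φ p.2)).2 ^ 2) atTop (𝓝 0) := by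
      refine squeeze_zero (fun p => sq_nonneg _) (fun p => ?_) hq2
      have h1 := mul_norm_sq_le_qform_add T (ell σ) hκ hTκ (w (φ p.1) - w (φ p.2))
      have h2 := qform_parallelogram T (ell σ) (w (φ p.1)) (w (φ p.2))
      have h3 := hnonneg _ (S.add_mem (hwS (φ p.1)) (hwS (φ p.2)))
      rw [Prod.snd_sub, Prod.fst_sub, ← dist_eq_norm, ← dist_eq_norm, ← hK] at h1
      rw [inv_mul_eq_div, le_div_iff₀' (by positivity)]
      linarith
    have h := hsq.sqrt
    simpa [Real.sqrt_sq dist_nonneg] using h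
  obtain ⟨x, hx⟩ := cauchySeq_tendsto_of_complete hcau
  obtain ⟨y, hy⟩ := cauchySeq_tendsto_of_complete hcau2
  have hlim : Tendsto (fun k => w (φ k)) atTop (𝓝 (x, y)) := hx.prodMk_nhds hy
  have hmem : (x, y) ∈ S := hSc.mem_of_tendsto hlim (Eventually.of_forall fun k => hwS _)
  have hy1 : ‖y‖ = 1 := by
    refine tendsto_nhds_unique hy.norm ?_
    simp_rw [hw1]
    exact tendsto_const_nhds
  have hq0 : qform T (ell σ) (x, y) = 0 :=
    tendsto_nhds_unique (((continuous_qform T (ell σ)).tendsto _).comp hlim) hqlim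
  -- The limit has `‖y‖ = 1` and null form, which coercivity at `λ₀` forbids.
  have hσpos : 0 < σ := by
    refine lt_of_le_of_ne hσ0 fun h0 => ?_
    rw [← h0, hell0] at hq0
    have := hcoer _ hmem
    rw [hq0, hy1] at this
    linarith
  refine ⟨σ, ⟨hσpos, hσ1⟩, (x, y), hmem, fun h => ?_,
    form_eq_zero_of_qform_eq_zero T _ hT hS hnonneg hmem hq0⟩
  have h2 : y = 0 := congrArg Prod.snd h
  rw [h2, norm_zero] at hy1
  exact zero_ne_one hy1

end Form

/-! ### Conjugation and the transpose. -/

theorem D_conj (j : Fin n) (s : ℂ) (f : E n → ℂ) :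
    D j (fun x => s * conj (f x)) = fun x => -s * conj (D j f x) := by
  have h1 : fderiv ℝ (fun x => conj (f x)) =
      fun x => (Complex.conjCLE : ℂ →L[ℝ] ℂ).comp (fderiv ℝ f x) := by
    ext1 x
    exact Complex.conjCLE.comp_fderiv
  have h2 : fderiv ℝ (fun x => s * conj (f x)) = fun x => s • fderiv ℝ (fun x => conj (f x)) x := by
    exact fderiv_const_smul_field (𝕜 := ℝ) (f := fun x => conj (f x)) s
  ext x
  simp [D, h2, h1]
  ring

theorem DPow_conj (α : Fin n →₀ ℕ) (f : E n → ℂ) :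
    DPow α (fun x => conj (f x)) = fun x => (-1) ^ (∑ j, α j) * conj (DPow α f x) := by
  have hit : ∀ (j : Fin n) (k : ℕ) (s : ℂ) (g : E n → ℂ),
      (D j)^[k] (fun x => s * conj (g x)) = fun x => (-1) ^ k * s * conj ((D j)^[k] g x) := by
    intro j k s g
    induction k with
    | zero => simp
    | succ k ih =>
      rw [Function.iterate_succ_apply', ih, D_conj, Function.iterate_succ_apply']
      ext x
      ring
  have h : ∀ l : List (Fin n), l.foldr (fun j g => (D j)^[α j] g) (fun x => conj (f x)) =
      fun x => (-1) ^ (l.map α).sum * conj (l.foldr (fun j g => (D j)^[α j] g) f x) := by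
    intro l
    induction l with
    | nil => simp
    | cons j l ih =>
      rw [List.foldr_cons, ih, hit, List.map_cons, List.sum_cons, pow_add]
      rfl
  rw [DPow, h, Fin.sum_univ_def]
  rfl

/-- Conjugating each `D_j` flips its sign and the coefficients are real, so the signs of the
transpose cancel. This passes between the bilinear distribution pairing and the sesquilinear `L²`
product. -/
theorem opDTranspose_conj (P : MvPolynomial (Fin n) ℝ) (f : E n → ℂ) (x : E n) :
    opDTranspose P (fun x => conj (f x)) x = conj (opD P f x) := by
  rw [opDTranspose, opD, map_sum]
  refine Finset.sum_congr rfl fun α _ => ?_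
  rw [DPow_conj, map_mul, Complex.conj_ofReal]
  have h : ((-1 : ℂ) ^ (∑ j, α j)) * (-1) ^ (∑ j, α j) = 1 := by
    rw [← mul_pow]; simp
  linear_combination ((P.coeff α : ℝ) : ℂ) * conj (DPow α f x) * h

/-- The complex conjugate of a test function. -/
def conjTest {Ω : TopologicalSpace.Opens (E n)} (φ : 𝓓(Ω, ℂ)) : 𝓓(Ω, ℂ) where
  toFun := fun x => conj (φ x)
  contDiff' := Complex.conjCLE.contDiff.comp φ.contDiff
  hasCompactSupport' := φ.hasCompactSupport.comp_left (map_zero _)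
  tsupport_subset' := (tsupport_comp_subset (map_zero (starRingEnd ℂ)) φ).trans φ.tsupport_subset

/-! ### The form `B_λ`, coercivity and transmission eigenvalues. -/

section Potential

variable {Ω : TopologicalSpace.Opens (E n)} {V : E n → ℝ}

theorem exists_ae_le (hV : MemLp V ∞ volume) :
    ∃ M : ℝ, 0 < M ∧ ∀ᵐ x ∂(volume.restrict (Ω : Set (E n))), V x ≤ M := by
  refine ⟨(eLpNorm V ∞ volume).toReal + 1, by positivity, ae_restrict_of_ae ?_⟩
  have h := ae_le_eLpNormEssSup (f := V) (μ := (volume : Measure (E n)))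
  filter_upwards [h] with x hx
  rw [← eLpNorm_exponent_top] at hx
  have h1 := ENNReal.toReal_mono hV.2.ne hx
  rw [toReal_enorm] at h1
  linarith [le_abs_self (V x), Real.norm_eq_abs (V x)]

theorem memLp_inv (hV : MemLp V ∞ volume) {δ : ℝ} (hδ : 0 < δ)
    (hVδ : ∀ᵐ x ∂(volume.restrict (Ω : Set (E n))), δ ≤ V x) :
    MemLp (fun x => ((1 / V x : ℝ) : ℂ)) ∞ (volume.restrict (Ω : Set (E n))) := by
  have hm : AEMeasurable (fun x => ((1 / V x : ℝ) : ℂ)) (volume.restrict (Ω : Set (E n))) :=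
    Complex.measurable_ofReal.comp_aemeasurable (hV.1.aemeasurable.restrict.const_div 1)
  refine memLp_top_of_bound hm.aestronglyMeasurable (1 / δ) ?_
  filter_upwards [hVδ] with x hx
  rw [Complex.norm_real, Real.norm_of_nonneg (by have := hδ.trans_le hx; positivity)]
  exact one_div_le_one_div_of_le hδ hx

variable (hinv : MemLp (fun x => ((1 / V x : ℝ) : ℂ)) ∞ (volume.restrict (Ω : Set (E n))))

theorem coeFn_sub_smul (u : L2 Ω × L2 Ω) (lam : ℝ) :
    (u.2 - (lam : ℂ) • u.1 : L2 Ω) =ᵐ[volume.restrict (Ω : Set (E n))]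
      fun x => u.2 x - (lam : ℂ) * u.1 x := by
  filter_upwards [Lp.coeFn_sub u.2 ((lam : ℂ) • u.1), Lp.coeFn_smul (lam : ℂ) u.1] with x hx hy
  rw [hx, Pi.sub_apply, hy]
  rfl

theorem inner_mulL2_symm (x y : L2 Ω) :
    inner ℂ x (mulL2 Ω hinv y) = inner ℂ (mulL2 Ω hinv x) y := by
  rw [L2.inner_def, L2.inner_def]
  refine integral_congr_ae ?_
  filter_upwards [coeFn_mulL2 Ω hinv x, coeFn_mulL2 Ω hinv y] with t hx hy
  simp only [hx, hy, RCLike.inner_apply, map_mul, Complex.conj_ofReal]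
  ring

theorem inv_mul_norm_sq_le_re_inner {M : ℝ}
    (hpos : ∀ᵐ x ∂(volume.restrict (Ω : Set (E n))), 0 < V x)
    (hVM : ∀ᵐ x ∂(volume.restrict (Ω : Set (E n))), V x ≤ M) (x : L2 Ω) :
    M⁻¹ * ‖x‖ ^ 2 ≤ (inner ℂ x (mulL2 Ω hinv x)).re := by
  have h1 : M⁻¹ * ‖x‖ ^ 2 = (inner ℂ x (((M⁻¹ : ℝ) : ℂ) • x)).re := by
    rw [inner_smul_right, Complex.re_ofReal_mul, inner_self_eq_norm_sq_to_K]
    norm_cast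
  rw [h1, L2.inner_def, L2.inner_def]
  change RCLike.re (K := ℂ) _ ≤ RCLike.re (K := ℂ) _
  rw [← integral_re (L2.integrable_inner _ _), ← integral_re (L2.integrable_inner _ _)]
  refine integral_mono_ae (L2.integrable_inner _ _).re (L2.integrable_inner _ _).re ?_
  filter_upwards [coeFn_mulL2 Ω hinv x, Lp.coeFn_smul (((M⁻¹ : ℝ) : ℂ)) x, hpos, hVM]
    with t hx hy h0 h2
  rw [hx, hy, Pi.smul_apply, smul_eq_mul]
  have h3 : ∀ a : ℝ, RCLike.re (inner ℂ (x t) ((a : ℂ) * x t)) = a * ‖x t‖ ^ 2 := by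
    intro a
    rw [← smul_eq_mul, inner_smul_right, inner_self_eq_norm_sq_to_K]
    change (_ : ℂ).re = _
    rw [Complex.re_ofReal_mul]
    norm_cast
  rw [h3, h3]
  refine mul_le_mul_of_nonneg_right ?_ (sq_nonneg _)
  rw [inv_eq_one_div]
  exact one_div_le_one_div_of_le h0 h2

theorem B_eq_form (hpos : ∀ᵐ x ∂(volume.restrict (Ω : Set (E n))), 0 < V x) (lam : ℝ)
    (u v : L2 Ω × L2 Ω) : B V Ω lam u v = form (mulL2 Ω hinv) lam u v := by
  rw [B, form, L2.inner_def, L2.inner_def,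
    ← integral_add (L2.integrable_inner _ _) (L2.integrable_inner _ _)]
  refine integral_congr_ae ?_
  filter_upwards [coeFn_mulL2 Ω hinv (u.2 - (lam : ℂ) • u.1), coeFn_sub_smul u lam,
    coeFn_sub_smul v lam, hpos] with x h1 h2 h3 h4
  have h5 : (V x : ℂ) ≠ 0 := by exact_mod_cast h4.ne'
  rw [h1, h2, h3]
  simp only [RCLike.inner_apply, map_sub, map_add, map_mul, Complex.conj_ofReal]
  push_cast
  field_simp
  ring

/-- If `|P(ξ) - λ| ≥ K` for some `K > sup V` then `B_λ` is coercive. -/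
theorem isCoerciveAt_of_le_abs_symbol_sub {P : MvPolynomial (Fin n) ℝ} {M : ℝ} (hM : 0 < M)
    (hpos : ∀ᵐ x ∂(volume.restrict (Ω : Set (E n))), 0 < V x)
    (hVM : ∀ᵐ x ∂(volume.restrict (Ω : Set (E n))), V x ≤ M)
    {lam K : ℝ} (hK : M < K) (h : ∀ ξ : E n, K ≤ |symbol P ξ - lam|) (hinv :
      MemLp (fun x => ((1 / V x : ℝ) : ℂ)) ∞ (volume.restrict (Ω : Set (E n)))) :
    IsCoerciveAt P V Ω lam := by
  have hK0 : 0 < K := hM.trans hK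
  have hd : 0 < M⁻¹ - K⁻¹ := sub_pos.2 (inv_strictAnti₀ hM hK)
  -- With `w = (P-λ)u` and `‖u.1‖ ≤ ‖w‖/K`, the form is at least `(M⁻¹ - K⁻¹)‖w‖²`, and `‖u.2‖ ≤ (1
  -- + |λ|/K)‖w‖`.
  refine ⟨(M⁻¹ - K⁻¹) / (1 + |lam| / K) ^ 2, by positivity, fun u hu => ?_⟩
  have h1 := mul_norm_le_of_le_abs_symbol_sub hK0 h (mem_H0Sub.2 hu)
  rw [B_eq_form hinv hpos, form, Complex.add_re]
  set w := u.2 - (lam : ℂ) • u.1 with hw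
  have h2 := inv_mul_norm_sq_le_re_inner hinv hpos hVM w
  have h3 := (abs_le.1 ((Complex.abs_re_le_norm _).trans (norm_inner_le_norm (𝕜 := ℂ) u.1 w))).1
  have h1' : ‖u.1‖ ≤ K⁻¹ * ‖w‖ := by rwa [inv_mul_eq_div, le_div_iff₀' hK0]
  have h4 : ‖u.1‖ * ‖w‖ ≤ K⁻¹ * ‖w‖ ^ 2 := by
    rw [sq, ← mul_assoc]
    exact mul_le_mul_of_nonneg_right h1' (norm_nonneg _)
  have h5 : ‖u.2‖ ≤ (1 + |lam| / K) * ‖w‖ := by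
    have h6 : u.2 = w + (lam : ℂ) • u.1 := by rw [hw]; abel
    calc ‖u.2‖ = ‖w + (lam : ℂ) • u.1‖ := by rw [← h6]
      _ ≤ ‖w‖ + ‖(lam : ℂ) • u.1‖ := norm_add_le _ _
      _ = ‖w‖ + |lam| * ‖u.1‖ := by rw [norm_smul, Complex.norm_real, Real.norm_eq_abs]
      _ ≤ ‖w‖ + |lam| * (K⁻¹ * ‖w‖) := by gcongr
      _ = _ := by ring
  have h6 := pow_le_pow_left₀ (norm_nonneg _) h5 2
  rw [mul_pow] at h6
  have h7 : (M⁻¹ - K⁻¹) / (1 + |lam| / K) ^ 2 * ‖u.2‖ ^ 2 ≤ (M⁻¹ - K⁻¹) * ‖w‖ ^ 2 := by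
    rw [div_mul_eq_mul_div, div_le_iff₀ (by positivity)]
    calc _ ≤ (M⁻¹ - K⁻¹) * ((1 + |lam| / K) ^ 2 * ‖w‖ ^ 2) := mul_le_mul_of_nonneg_left h6 hd.le
      _ = _ := by ring
  linarith

/-- A nonzero element of the kernel of `B_λ` makes `λ` a transmission eigenvalue. -/
theorem isTransmissionEigenvalue_of_form_eq_zero {P : MvPolynomial (Fin n) ℝ}
    (hP : 1 ≤ P.totalDegree) (hΩ : Bornology.IsBounded (Ω : Set (E n))) {M : ℝ} (hM : 0 < M)
    (hpos : ∀ᵐ x ∂(volume.restrict (Ω : Set (E n))), 0 < V x)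
    (hVM : ∀ᵐ x ∂(volume.restrict (Ω : Set (E n))), V x ≤ M) {lam : ℝ} {u : L2 Ω × L2 Ω}
    (hu : u ∈ H0Sub P Ω) (hu0 : u ≠ 0)
    (h : ∀ v ∈ H0Sub P Ω, form (mulL2 Ω hinv) lam u v = 0) :
    IsTransmissionEigenvalue P V Ω (lam : ℂ) := by
  set W : L2 Ω := mulL2 Ω hinv (u.2 - (lam : ℂ) • u.1) with hWdef
  have hW : W =ᵐ[volume.restrict (Ω : Set (E n))]
      fun x => ((1 / V x : ℝ) : ℂ) * (u.2 x - (lam : ℂ) * u.1 x) := by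
    filter_upwards [coeFn_mulL2 Ω hinv (u.2 - (lam : ℂ) • u.1), coeFn_sub_smul u lam] with x h1 h2
    rw [h1, h2]
  have hloc : ∀ z : L2 Ω, MemL2Loc Ω z := fun z K _ hK =>
    (Lp.memLp z).mono_measure (Measure.restrict_mono hK le_rfl)
  have htest : ∀ ψ : 𝓓(Ω, ℂ), ∃ p ∈ H0Sub P Ω,
      (∀ᵐ x ∂volume.restrict (Ω : Set (E n)), conj (p.1 x) = ψ x) ∧
      ∀ᵐ x ∂volume.restrict (Ω : Set (E n)), conj (p.2 x) = opDTranspose P ψ x := by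
    intro ψ
    refine ⟨_, graphMap_mem (toSchwartz_mem (conjTest ψ)), ?_, ?_⟩
    · filter_upwards [coeFn_res Ω (toSchwartz (conjTest ψ))] with x hx
      have h1 : (graphMap P Ω (toSchwartz (conjTest ψ))).1 x = conj (ψ x) := hx
      rw [h1, Complex.conj_conj]
    · filter_upwards [coeFn_res Ω (Op (complexify P) (toSchwartz (conjTest ψ)))] with x hx
      have h1 : (graphMap P Ω (toSchwartz (conjTest ψ))).2 x =
          opD P (fun x => conj (ψ x)) x := by
        exact hx.trans (congrFun (opD_eq_Op P (toSchwartz (conjTest ψ))) x).symm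
      rw [h1, ← opDTranspose_conj]
      simp only [Complex.conj_conj]
  -- If `u + W = 0` then `(P-λ)u = -Vu`; if `W = 0` then `(P-λ)u = 0`. Both give `u = 0` by unique
  -- continuation. The first equation uses symmetry of `P(D)` to move `P - λ` onto the test
  -- function; the second is `B_λ(u,p) = 0` itself.
  refine ⟨(u.1 + W : L2 Ω), W, hloc _, hloc _, fun hv => hu0 ?_, fun hw => hu0 ?_, fun ψ => ?_,
    fun ψ => ?_, u, mem_H0Sub.1 hu, ?_⟩
  · refine eq_zero_of_norm_sub_le P hP lam hΩ hM.le hu ?_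
    filter_upwards [hv, Lp.coeFn_add u.1 W, hW, hpos, hVM] with x h1 h2 h3 h4 h5
    have h6 : (V x : ℂ) ≠ 0 := by exact_mod_cast h4.ne'
    rw [h2, Pi.add_apply, h3, Pi.zero_apply] at h1
    have h7 : u.2 x - (lam : ℂ) * u.1 x = -((V x : ℂ) * u.1 x) := by
      push_cast at h1
      field_simp at h1
      linear_combination h1
    rw [h7, norm_neg, norm_mul, Complex.norm_real, Real.norm_of_nonneg h4.le]
    exact mul_le_mul_of_nonneg_right h5 (norm_nonneg _)
  · refine eq_zero_of_norm_sub_le P hP lam hΩ le_rfl hu ?_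
    filter_upwards [hw, hW, hpos] with x h1 h3 h4
    have h6 : ((1 / V x : ℝ) : ℂ) ≠ 0 := by exact_mod_cast (one_div_pos.2 h4).ne'
    rw [h3, Pi.zero_apply] at h1
    rw [(mul_eq_zero.1 h1).resolve_left h6]
    simp
  · obtain ⟨p, hp, hp1, hp2⟩ := htest ψ
    have h1 : form (mulL2 Ω hinv) lam u p =
        inner ℂ (p.2 - (lam : ℂ) • p.1) (u.1 + W) := by
      have h2 : inner ℂ p.1 (u.2 - (lam : ℂ) • u.1) = inner ℂ (p.2 - (lam : ℂ) • p.1) u.1 := by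
        rw [inner_sub_right, inner_sub_left, inner_smul_left, inner_smul_right,
          Complex.conj_ofReal, inner_symm_of_mem_H0Sub hp hu]
      rw [form, ← hWdef, inner_add_right, add_comm, h2]
    rw [h p hp, L2.inner_def] at h1
    rw [h1]
    refine integral_congr_ae ?_
    filter_upwards [hp1, hp2, coeFn_sub_smul p lam] with x h2 h3 h4
    simp only [h4, RCLike.inner_apply, map_sub, map_mul, Complex.conj_ofReal, h2, h3]
    simp
  · obtain ⟨p, hp, hp1, hp2⟩ := htest ψ
    have h1 := h p hp
    rw [← B_eq_form hinv hpos, B] at h1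
    rw [← h1]
    refine integral_congr_ae ?_
    filter_upwards [hp1, hp2, hW] with x h2 h3 h4
    rw [h4, map_sub, map_add, map_mul, map_mul, Complex.conj_ofReal, Complex.conj_ofReal, h2, h3]
  · filter_upwards [Lp.coeFn_add u.1 W] with x hx
    rw [hx, Pi.add_apply, add_sub_cancel_right]

end Potential

end ITP

end

/-! ### The main theorem. -/

theorem theorem4p2 {n : ℕ} (P : MvPolynomial (Fin n) ℝ) (hP : 2 ≤ P.totalDegree)
    (hPtilde : Tendsto (ITP.symbolTilde P) (cocompact (ITP.E n)) atTop)
    (Ω : TopologicalSpace.Opens (ITP.E n))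
    (hΩconn : IsConnected (Ω : Set (ITP.E n)))
    (hΩbdd : Bornology.IsBounded (Ω : Set (ITP.E n)))
    (V : ITP.E n → ℝ) (hV : MemLp V ∞ volume)
    (hVsupp : ITP.essSupport V = closure (Ω : Set (ITP.E n)))
    (δ : ℝ) (hδ : 0 < δ)
    (hVδ : ∀ᵐ x ∂(volume.restrict (closure (Ω : Set (ITP.E n)))), δ ≤ V x) :
    (ITP.SemiboundedSymbol P → ∃ lam₀ : ℝ, ITP.IsCoerciveAt P V Ω lam₀) ∧
    ∀ lam₀ : ℝ, ITP.IsCoerciveAt P V Ω lam₀ →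
      ∀ lam : ℝ, (∃ u ∈ ITP.H0 P Ω, u ≠ 0 ∧ (ITP.B V Ω lam u u).re ≤ 0) →
        (lam₀ < lam → ∃ mu : ℝ, mu ∈ Set.Ioc lam₀ lam ∧
          ITP.IsTransmissionEigenvalue P V Ω (mu : ℂ)) ∧
        (lam < lam₀ → ∃ mu : ℝ, mu ∈ Set.Ico lam lam₀ ∧
          ITP.IsTransmissionEigenvalue P V Ω (mu : ℂ)) := by
  have hP1 : 1 ≤ P.totalDegree := by omega
  have hVδ' : ∀ᵐ x ∂(volume.restrict (Ω : Set (ITP.E n))), δ ≤ V x :=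
    ae_restrict_of_ae_restrict_of_subset subset_closure hVδ
  have hpos : ∀ᵐ x ∂(volume.restrict (Ω : Set (ITP.E n))), 0 < V x :=
    hVδ'.mono fun x hx => hδ.trans_le hx
  have hinv := ITP.memLp_inv hV hδ hVδ'
  obtain ⟨M, hM, hVM⟩ := ITP.exists_ae_le (Ω := Ω) hV
  constructor
  · rintro (⟨C, hC⟩ | ⟨C, hC⟩)
    -- Any distance from the range of the symbol exceeding `M` works; `K = M + 1` is used.
    · refine ⟨C - (M + 1), ITP.isCoerciveAt_of_le_abs_symbol_sub hM hpos hVM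
        (lt_add_one M) (fun ξ => le_trans ?_ (le_abs_self _)) hinv⟩
      linarith [hC ξ]
    · refine ⟨-C + (M + 1), ITP.isCoerciveAt_of_le_abs_symbol_sub hM hpos hVM
        (lt_add_one M) (fun ξ => le_trans ?_ (neg_le_abs _)) hinv⟩
      linarith [hC ξ]
  · rintro lam₀ ⟨c, hc, hcoer⟩ lam ⟨u₁, hu₁, hu₁0, hq₁⟩
    obtain ⟨C, hC, hCu⟩ := ITP.exists_norm_fst_le P hP1 hΩbdd
    have hB : ∀ (l : ℝ) (u : ITP.L2 Ω × ITP.L2 Ω),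
        ITP.qform (ITP.mulL2 Ω hinv) l u = (ITP.B V Ω l u u).re := fun l u => by
      rw [ITP.qform, ITP.B_eq_form hinv hpos]
    obtain ⟨s, hs, u, hu, hu0, hker⟩ := ITP.exists_kernel (ITP.mulL2 Ω hinv)
      (ITP.isClosed_H0Sub P Ω) (ITP.inner_mulL2_symm hinv) (inv_pos.2 hM)
      (ITP.inv_mul_norm_sq_le_re_inner hinv hpos hVM)
      (fun u hu v hv => ITP.inner_symm_of_mem_H0Sub hu hv) hC hCu
      (fun u hu h1 => ITP.exists_cauchySeq_fst hP1 hPtilde hΩbdd u hu h1)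
      (lam₀ := lam₀) (lam₁ := lam) hc
      (fun u hu => (hcoer u (ITP.mem_H0Sub.1 hu)).trans_eq (hB lam₀ u).symm)
      (ITP.mem_H0Sub.2 hu₁) hu₁0 ((hB lam u₁).trans_le hq₁)
    have hev := ITP.isTransmissionEigenvalue_of_form_eq_zero hinv hP1 hΩbdd hM hpos hVM hu hu0 hker
    -- One eigenvalue `lam₀ + s (lam - lam₀)` with `0 < s ≤ 1` serves both orderings: `0 < s`
    -- excludes `lam₀` and `s ≤ 1` admits `lam`.
    refine ⟨fun hlt => ⟨_, ⟨?_, ?_⟩, hev⟩, fun hlt => ⟨_, ⟨?_, ?_⟩, hev⟩⟩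
    · nlinarith [mul_pos hs.1 (sub_pos.2 hlt)]
    · nlinarith [mul_nonneg (sub_nonneg.2 hs.2) (sub_pos.2 hlt).le]
    · nlinarith [mul_nonneg (sub_nonneg.2 hs.2) (sub_pos.2 hlt).le]
    · nlinarith [mul_pos hs.1 (sub_pos.2 hlt)]
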